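/- Let $h=(h_1,\dots,h_{m_1})$ and $g=(g_1,\dots,g_{m_2})$ be tuples of polynomials in $\mathbb{R}[x]=\mathbb{R}[x_1,\dots,x_n]$, let $K=\{x\in\mathbb{R}^n: h(x)=0,\ g(x)\ge 0\}$, let $\mathcal{A}\subseteq\mathbb{N}^n$ be finite with $\deg(\mathcal{A})=\max\{|\alpha|:\alpha\in\mathcal{A}\}$, and let $\mathbb{R}[x]_{\mathcal{A}}=\mathrm{span}\{x^\alpha:\alpha\in\mathcal{A}\}$. For $p\in\mathbb{R}[x]_{\mathcal{A}}$ and $y\in\mathbb{R}^{\mathcal{A}}$ write $\langle p,y\rangle=\sum_{\alpha\in\mathcal{A}}p_\alpha y_\alpha$. Let $\mathscr{R}_{\mathcal{A}}(K)$ be the set of $y\in\mathbb{R}^{\mathcal{A}}$ for which there is a Borel measure $\mu$ supported in $K$ with $y_\alpha=\int x^\alpha\,d\mu$ for all $\alpha\in\mathcal{A}$. Let $a_1,\dots,a_m\in\mathbb{R}[x]_{\mathcal{A}}$ and $b\in\mathbb{R}^m$, and consider the problem (P) find $y\in\mathscr{R}_{\mathcal{A}}(K)$ with $\langle a_i,y\rangle=b_i$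 $(i=1,\dots,m)$. Let $\mathbb{N}^n_d=\{\alpha\in\mathbb{N}^n:|\alpha|\le d\}$. For $w\in\mathbb{R}^{\mathbb{N}^n_{2k}}$ and a polynomial $q$, let $L_q^{(k)}(w)$ be the localizing matrix, i.e. the symmetric matrix with $p^TL_q^{(k)}(w)p=\langle qp^2,w\rangle$ for all $p$ with $\deg(qp^2)\le 2k$ (the empty matrix if $\deg q>2k$). Put $g_0=1$, $\Phi_k(g)=\{w: L_{g_j}^{(k)}(w)\succeq 0,\ j=0,\dots,m_2\}$ and $E_k(h)=\{w: L_{h_i}^{(k)}(w)=0,\ i=1,\dots,m_1\}$. The relaxation of order $k\in\mathbb{N}$ is (P$_k$) find $y\in\mathscr{S}^k_{\mathcal{A}}(K)$ with $\langle a_i,y\rangle=b_i$ $(i=1,\dots,m)$, where $\mathscr{S}^k_{\mathcal{A}}(K)=\{w|_{\mathcal{A}}: w\in\Phi_k(g)\cap E_k(h)\}$ if $2k\ge\deg(\mathcal{A})$, and $\mathscr{S}^k_{\mathcal{A}}(K)=\mathbb{R}^{\mathcal{A}}$ if $2k<\deg(\mathcal{A})$. With $\Sigma_{n,d}$ the cone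 of sums of squares of degree at most $d$ and $\mathbb{R}[x]_d$ the polynomials of degree at most $d$ ($\Sigma_{n,d}=\mathbb{R}[x]_d=\{0\}$ for $d<0$), let $Q_k(g)=\Sigma_{n,2k}+\sum_j g_j\Sigma_{n,2k-\deg g_j}$, $Q(g)=\bigcup_kQ_k(g)$, $I_{2k}(h)=\sum_i h_i\mathbb{R}[x]_{2k-\deg h_i}$, and let $I(h)$ be the ideal generated by $h$. Say that $\lambda\in\mathbb{R}^m$ is a certificate of order $k$ if $$b^T\lambda<0,\qquad \lambda_1a_1+\cdots+\lambda_ma_m\in Q_k(g)+I_{2k}(h).$$ (i) If (P$_k$) is infeasible for some $k$, then (P) is infeasible. If there is a certificate of order $k$, then (P$_{k'}$) is infeasible for every $k'>k$ with $2k'\ge\deg(\mathcal{A})$; if all the degrees $\deg(h_i)$ are even, it is infeasible also for $k'=k$, provided that $2k\ge\deg(\mathcal{A})$. (ii) Suppose that $I(h)+Q(g)$ is archimedean, i.e. $R-\|x\|_2^2\in I(h)+Q(g)$ for some $R>0$, and that some $a\in\mathrm{span}\{a_1,\dots,a_m\}$ is positive on $K$. If (P) is infeasible, then there exist $\lambda\in\mathbb{R}^m$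 and $k$ with $2k\ge\deg(\mathcal{A})$ such that $\lambda$ is a certificate of order $k$ and (P$_{k'}$) is infeasible for every $k'\ge k$. -/

import Mathlib

open MvPolynomial MeasureTheory

noncomputable section

namespace MomCone

/-- The exponent set `ℕ^n_d = {α ∈ ℕ^n : |α| ≤ d}`. -/
def expLE (n d : ℕ) : Finset (Fin n →₀ ℕ) :=
  (Finset.range (d + 1)).biUnion fun i => Finset.finsuppAntidiag Finset.univ i

theorem mem_expLE {n d : ℕ} {α : Fin n →₀ ℕ} : α ∈ expLE n d ↔ α.degree ≤ d := by
  simp [expLE, Finset.mem_finsuppAntidiag, Finsupp.degree_eq_sum]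

/-- `deg(A) = max {|α| : α ∈ A}` (and `0` for `A = ∅`). -/
def degSet {n : ℕ} (A : Finset (Fin n →₀ ℕ)) : ℕ := A.sup Finsupp.degree

/-- `ℝ[x]_A`, the span of the monomials `x^α`, `α ∈ A`. -/
def polysOn {n : ℕ} (A : Finset (Fin n →₀ ℕ)) : Submodule ℝ (MvPolynomial (Fin n) ℝ) :=
  Submodule.span ℝ ((fun α => monomial α (1 : ℝ)) '' (A : Set (Fin n →₀ ℕ)))

/-- The Riesz pairing `⟨p, y⟩ = ∑_{α ∈ A} p_α y_α` of `p ∈ ℝ[x]_A` with `y ∈ ℝ^A`. -/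
def riesz {n : ℕ} {A : Finset (Fin n →₀ ℕ)} (p : MvPolynomial (Fin n) ℝ) (y : A → ℝ) : ℝ :=
  ∑ α : A, p.coeff (α : Fin n →₀ ℕ) * y α

/-- `K = {x ∈ ℝ^n : h(x) = 0, g(x) ≥ 0}`. -/
def semialgSet {n m₁ m₂ : ℕ} (h : Fin m₁ → MvPolynomial (Fin n) ℝ)
    (g : Fin m₂ → MvPolynomial (Fin n) ℝ) : Set (Fin n → ℝ) :=
  {u | (∀ i, eval u (h i) = 0) ∧ ∀ j, 0 ≤ eval u (g j)}

/-- The cone `R_A(K)` of all `y ∈ ℝ^A` that have a `K`-representing measure: a Borel measure `μ`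
on `ℝ^n`, supported in `K`, with `y_α = ∫ x^α dμ` for all `α ∈ A`. -/
def momentCone {n : ℕ} (A : Finset (Fin n →₀ ℕ)) (K : Set (Fin n → ℝ)) : Set (A → ℝ) :=
  {y | ∃ μ : Measure (Fin n → ℝ), μ Kᶜ = 0 ∧
    ∀ α : A, Integrable (fun u : Fin n → ℝ => ∏ i, u i ^ (α : Fin n →₀ ℕ) i) μ ∧
      y α = ∫ u : Fin n → ℝ, ∏ i, u i ^ (α : Fin n →₀ ℕ) i ∂μ}

/-- Row and column indices of the `k`-th localizing matrix of `q`: the exponents `α` with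
`deg(q) + 2|α| ≤ 2k` (none if `deg(q) > 2k`). -/
def locIndex {n : ℕ} (q : MvPolynomial (Fin n) ℝ) (k : ℕ) : Finset (Fin n →₀ ℕ) :=
  (expLE n k).filter fun α => q.totalDegree + 2 * α.degree ≤ 2 * k

/-- The `k`-th order localizing matrix `L_q^{(k)}(w)` of `q` generated by `w ∈ ℝ^{ℕ^n_{2k}}`:
its quadratic form is `p ↦ ⟨q p², w⟩` on the polynomials `p` with `deg(q p²) ≤ 2k`. -/
def locMatrix {n : ℕ} (q : MvPolynomial (Fin n) ℝ) (k : ℕ) (w : expLE n (2 * k) → ℝ) :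
    Matrix (locIndex q k) (locIndex q k) ℝ :=
  fun α β => riesz (q * monomial ((α : Fin n →₀ ℕ) + (β : Fin n →₀ ℕ)) 1) w

/-- `Φ_k(g)`: all `w ∈ ℝ^{ℕ^n_{2k}}` whose moment matrix (the case `g_0 = 1`) and localizing
matrices of the `g_j` are positive semidefinite. -/
def Phi {n m₂ : ℕ} (g : Fin m₂ → MvPolynomial (Fin n) ℝ) (k : ℕ) :
    Set (expLE n (2 * k) → ℝ) :=
  {w | (locMatrix 1 k w).PosSemidef ∧ ∀ j, (locMatrix (g j) k w).PosSemidef}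

/-- `E_k(h)`: all `w ∈ ℝ^{ℕ^n_{2k}}` whose localizing matrices of the `h_i` vanish. -/
def Ek {n m₁ : ℕ} (h : Fin m₁ → MvPolynomial (Fin n) ℝ) (k : ℕ) :
    Set (expLE n (2 * k) → ℝ) :=
  {w | ∀ i, locMatrix (h i) k w = 0}

/-- The relaxation `S_A^k(K) = {w|_A : w ∈ Φ_k(g) ∩ E_k(h)}` of `R_A(K)`; for `2k < deg(A)` it is
all of `ℝ^A` by convention. If `deg(A) ≤ 2k`, every `α ∈ A` lies in `ℕ^n_{2k}`, so the last
clause says `y = w|_A`. -/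
def relaxCone {n m₁ m₂ : ℕ} (A : Finset (Fin n →₀ ℕ)) (h : Fin m₁ → MvPolynomial (Fin n) ℝ)
    (g : Fin m₂ → MvPolynomial (Fin n) ℝ) (k : ℕ) : Set (A → ℝ) :=
  {y | degSet A ≤ 2 * k → ∃ w ∈ Phi g k ∩ Ek h k,
    ∀ (α : A) (hα : (α : Fin n →₀ ℕ) ∈ expLE n (2 * k)), y α = w ⟨α, hα⟩}

/-- The feasible set of the moment problem: `⟨a_i, y⟩ = b_i` for all `i`, and `y ∈ R_A(K)`. -/
def momentFeasible {n m m₁ m₂ : ℕ} (A : Finset (Fin n →₀ ℕ))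
    (h : Fin m₁ → MvPolynomial (Fin n) ℝ) (g : Fin m₂ → MvPolynomial (Fin n) ℝ)
    (a : Fin m → MvPolynomial (Fin n) ℝ) (b : Fin m → ℝ) : Set (A → ℝ) :=
  {y | (∀ i, riesz (a i) y = b i) ∧ y ∈ momentCone A (semialgSet h g)}

/-- The feasible set (in `y`) of the `k`-th order relaxation: `⟨a_i, y⟩ = b_i` for all `i`, and
`y ∈ S_A^k(K)`. -/
def relaxFeasible {n m m₁ m₂ : ℕ} (A : Finset (Fin n →₀ ℕ))
    (h : Fin m₁ → MvPolynomial (Fin n) ℝ) (g : Fin m₂ → MvPolynomial (Fin n) ℝ)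
    (a : Fin m → MvPolynomial (Fin n) ℝ) (b : Fin m → ℝ) (k : ℕ) : Set (A → ℝ) :=
  {y | (∀ i, riesz (a i) y = b i) ∧ y ∈ relaxCone A h g k}

/-- `I_ℓ(h) = ∑_i h_i ℝ[x]_{ℓ - deg(h_i)}`. The bound on `deg(h_i p_i)` is `deg(p_i) ≤ ℓ - deg(h_i)`
for nonzero `h_i`, `p_i`, and forces `p_i = 0` if `h_i ≠ 0` has degree above `ℓ`. -/
def truncIdeal {n m₁ : ℕ} (h : Fin m₁ → MvPolynomial (Fin n) ℝ) (l : ℕ) :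
    Set (MvPolynomial (Fin n) ℝ) :=
  {f | ∃ p : Fin m₁ → MvPolynomial (Fin n) ℝ,
    (∀ i, (h i * p i).totalDegree ≤ l) ∧ f = ∑ i, h i * p i}

/-- `Q_k(g) = Σ_{n,2k} + ∑_j g_j Σ_{n,2k - deg(g_j)}`, where `Σ_{n,d}` is the cone of sums of
squares of degree at most `d`. -/
def truncQM {n m₂ : ℕ} (g : Fin m₂ → MvPolynomial (Fin n) ℝ) (k : ℕ) :
    Set (MvPolynomial (Fin n) ℝ) :=
  {f | ∃ (s₀ : MvPolynomial (Fin n) ℝ) (s : Fin m₂ → MvPolynomial (Fin n) ℝ),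
    IsSumSq s₀ ∧ s₀.totalDegree ≤ 2 * k ∧
    (∀ j, IsSumSq (s j) ∧ (g j * s j).totalDegree ≤ 2 * k) ∧
    f = s₀ + ∑ j, g j * s j}

/-- The quadratic module `Q(g) = ⋃_k Q_k(g)`. -/
def quadModule {n m₂ : ℕ} (g : Fin m₂ → MvPolynomial (Fin n) ℝ) :
    Set (MvPolynomial (Fin n) ℝ) :=
  ⋃ k, truncQM g k

/-- `I(h) + Q(g)` is archimedean: it contains `R - ‖x‖²` for some `R > 0`. -/
def IsArchimedean {n m₁ m₂ : ℕ} (h : Fin m₁ → MvPolynomial (Fin n) ℝ)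
    (g : Fin m₂ → MvPolynomial (Fin n) ℝ) : Prop :=
  ∃ R : ℝ, 0 < R ∧ ∃ f ∈ Ideal.span (Set.range h), ∃ q ∈ quadModule g,
    C R - ∑ i, X i ^ 2 = f + q

/-- `λ` is an infeasibility certificate of order `k`: `bᵀλ < 0` and
`∑ λ_i a_i ∈ Q_k(g) + I_{2k}(h)`. -/
def IsCertificate {n m m₁ m₂ : ℕ} (h : Fin m₁ → MvPolynomial (Fin n) ℝ)
    (g : Fin m₂ → MvPolynomial (Fin n) ℝ) (a : Fin m → MvPolynomial (Fin n) ℝ)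
    (b : Fin m → ℝ) (lam : Fin m → ℝ) (k : ℕ) : Prop :=
  ∑ i, b i * lam i < 0 ∧
    ∃ q ∈ truncQM g k, ∃ f ∈ truncIdeal h (2 * k), ∑ i, lam i • a i = q + f

end MomCone

end

/-! Infeasibility passes from the relaxations to (P) because the moment cone lies in every relaxed
cone. A representing measure need not have moments outside `A`, so its sequence cannot simply be
prolonged to degree `2k`. Richter's theorem (`integral_mem_cone`) instead writes `y` as a conic
combination of monomial vectors at points of `K`. Each of these extends to a point evaluation, whose
localizing matrices are `q(u) v vᵀ`.

A certificate excludes a relaxed solution `w` by pairing: `w` is nonnegative on the sums-of-squares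
part and zero on the ideal part, while the pairing equals `bᵀλ < 0`. The degree bounds survive
because leading forms of nonnegative polynomials do not cancel; the zero part requires splitting
each exponent into two halves, where parity enters.

For (ii), `K` is compact, so the vectors `(a_i(u))` with `u ∈ K` form a compact set, lying in an
open half space by positivity of `a`. Infeasibility puts `b` outside the cone they generate, since
finitely atomic measures realize that cone. Strict separation yields `λ` with `bᵀλ < 0` and `∑ λ_i
a_i > 0` on `K`, and Putinar's Positivstellensatz makes `λ` a certificate.

Putinar's theorem is proved by convexity: for an archimedean quadratic module the extreme states are
multiplicative (`extreme_map_mul`), and an element outside the module is nonpositive at one of them.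
-/

noncomputable section

namespace MomCone

/-! ### Archimedean quadratic modules and their extreme states -/

section QuadraticModules

variable {V : Type*} [CommRing V]

/-- `M` is a quadratic module of the commutative `ℝ`-algebra `V`. -/
structure IsQuadModule (M : Set V) : Prop where
  one_mem : 1 ∈ M
  add_mem : ∀ {p q}, p ∈ M → q ∈ M → p + q ∈ M
  sq_mul_mem : ∀ (a) {q}, q ∈ M → a ^ 2 * q ∈ M

theorem IsQuadModule.sq_mem {M : Set V} (hM : IsQuadModule M) (a : V) : a ^ 2 ∈ M := by
  simpa using hM.sq_mul_mem a hM.one_mem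

theorem IsQuadModule.zero_mem {M : Set V} (hM : IsQuadModule M) : (0 : V) ∈ M := by
  simpa using hM.sq_mem 0

variable [Algebra ℝ V]

theorem IsQuadModule.smul_mem {M : Set V} (hM : IsQuadModule M) {c : ℝ} (hc : 0 ≤ c) {q : V}
    (hq : q ∈ M) : c • q ∈ M := by
  have := hM.sq_mul_mem (algebraMap ℝ V (Real.sqrt c)) hq
  rwa [← map_pow, Real.sq_sqrt hc, ← Algebra.smul_def] at this

theorem IsQuadModule.algebraMap_mem {M : Set V} (hM : IsQuadModule M) {c : ℝ} (hc : 0 ≤ c) :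
    algebraMap ℝ V c ∈ M := by
  rw [Algebra.algebraMap_eq_smul_one]; exact hM.smul_mem hc hM.one_mem

/-- Every element is bounded above by a constant modulo `M`. -/
def ArchimedeanModule (M : Set V) : Prop := ∀ p : V, ∃ N : ℝ, algebraMap ℝ V N - p ∈ M

/-- The linear functionals that are nonnegative on `M`. -/
def NonnegOn (M : Set V) (L : V →ₗ[ℝ] ℝ) : Prop := ∀ p ∈ M, 0 ≤ L p

theorem map_algebraMap (L : V →ₗ[ℝ] ℝ) (c : ℝ) : L (algebraMap ℝ V c) = c * L 1 := by
  rw [Algebra.algebraMap_eq_smul_one]; simp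

theorem NonnegOn.eq_zero {M : Set V} (hA : ArchimedeanModule M) {L : V →ₗ[ℝ] ℝ}
    (hL : NonnegOn M L) (h1 : L 1 = 0) : L = 0 := by
  ext p
  obtain ⟨N, hN⟩ := hA p
  obtain ⟨N', hN'⟩ := hA (-p)
  have e1 := hL _ hN
  have e2 := hL _ hN'
  simp only [map_sub, map_neg, map_algebraMap, h1] at e1 e2
  simp only [LinearMap.zero_apply]
  linarith

/-- Cauchy–Schwarz inequality for the weight `q`. -/
theorem NonnegOn.cauchySchwarz {M : Set V} (hM : IsQuadModule M) {L : V →ₗ[ℝ] ℝ}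
    (hL : NonnegOn M L) (a : V) {q : V} (hq : q ∈ M) :
    L (a * q) ^ 2 ≤ L q * L (a ^ 2 * q) := by
  have h : ∀ t : ℝ, 0 ≤ L q * (t * t) + (2 * L (a * q)) * t + L (a ^ 2 * q) := by
    intro t
    have h0 := hL _ (hM.sq_mul_mem (a + algebraMap ℝ V t) hq)
    have e : (a + algebraMap ℝ V t) ^ 2 * q
        = (t * t) • q + (2 * t) • (a * q) + a ^ 2 * q := by
      simp only [Algebra.smul_def, map_mul, map_ofNat]; ring
    rw [e] at h0
    simp only [map_add, map_smul, smul_eq_mul] at h0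
    linarith
  have := discrim_le_zero h
  rw [discrim] at this
  nlinarith

theorem NonnegOn.map_pow_two_mul_le_one {M : Set V} (hM : IsQuadModule M) {L : V →ₗ[ℝ] ℝ}
    (hL : NonnegOn M L) {a : V} (ha : 1 - a ^ 2 ∈ M) (e : ℕ) : L ((a ^ e) ^ 2) ≤ L 1 := by
  induction e with
  | zero => simp
  | succ e ih =>
    have h0 := hL _ (hM.sq_mul_mem (a ^ e) ha)
    have : (a ^ e) ^ 2 * (1 - a ^ 2) = (a ^ e) ^ 2 - (a ^ (e + 1)) ^ 2 := by ring
    rw [this, map_sub] at h0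
    linarith

theorem le_one_of_pow_two_pow_le {r B : ℝ} (h : ∀ j : ℕ, r ^ 2 ^ j ≤ B) : r ≤ 1 := by
  by_contra! hr
  obtain ⟨j, hj⟩ := pow_unbounded_of_one_lt B hr
  have : r ^ j ≤ r ^ 2 ^ j := pow_le_pow_right₀ hr.le Nat.lt_two_pow_self.le
  linarith [h j]

/-- A functional that is nonnegative on a quadratic module is nonnegative on `(1 - a²) M` if
`1 - a² ∈ M`. -/
theorem NonnegOn.sq_mul_le {M : Set V} (hM : IsQuadModule M) {L : V →ₗ[ℝ] ℝ}
    (hL : NonnegOn M L) {a : V} (ha : 1 - a ^ 2 ∈ M) {q : V} (hq : q ∈ M) :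
    L (a ^ 2 * q) ≤ L q := by
  -- The product `(1 - a²) q` need not lie in `M`. Cauchy–Schwarz makes `(x 0 / L q) ^ 2 ^ j ≤ x j /
  -- L q`, and `x` is bounded, so the ratio cannot exceed `1`.
  set x : ℕ → ℝ := fun j => L ((a ^ 2 ^ j) ^ 2 * q) with hx
  have hx0 : ∀ j, 0 ≤ x j := fun j => hL _ (hM.sq_mul_mem _ hq)
  have hxs : ∀ j, x j ^ 2 ≤ L q * x (j + 1) := by
    intro j
    have := hL.cauchySchwarz hM ((a ^ 2 ^ j) ^ 2) hq
    have e : (a ^ 2 ^ j) ^ 2 = a ^ 2 ^ (j + 1) := by rw [← pow_mul, pow_succ]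
    simpa only [hx, ← e] using this
  -- From `(b - q)² ∈ M` with `b = (a ^ 2 ^ j) ^ 2`, since `L (b ^ 2) ≤ L 1`.
  have hxB : ∀ j, x j ≤ (L 1 + L (q ^ 2)) / 2 := by
    intro j
    have h0 := hL _ (hM.sq_mem ((a ^ 2 ^ j) ^ 2 - q))
    have e : ((a ^ 2 ^ j) ^ 2 - q) ^ 2
        = (a ^ (2 ^ j * 2)) ^ 2 + q ^ 2 - (2 : ℝ) • ((a ^ 2 ^ j) ^ 2 * q) := by
      rw [Algebra.smul_def, map_ofNat]; ring
    rw [e] at h0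
    simp only [map_sub, map_add, map_smul, smul_eq_mul] at h0
    have := hL.map_pow_two_mul_le_one hM ha (2 ^ j * 2)
    simp only [hx]; linarith
  have hq0 : 0 ≤ L q := hL _ hq
  have hx00 : x 0 = L (a ^ 2 * q) := by simp [hx]
  rw [← hx00]
  rcases hq0.eq_or_lt with h0 | h0
  · have := hxs 0
    rw [← h0, zero_mul] at this
    have := pow_eq_zero_iff (two_ne_zero) |>.1 (le_antisymm this (sq_nonneg _))
    linarith
  · have hr : ∀ j, (x 0 / L q) ^ 2 ^ j ≤ x j / L q := by
      intro j
      induction j with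
      | zero => simp
      | succ j ih =>
        have hn : 0 ≤ (x 0 / L q) ^ 2 ^ j := pow_nonneg (div_nonneg (hx0 0) hq0) _
        calc (x 0 / L q) ^ 2 ^ (j + 1) = ((x 0 / L q) ^ 2 ^ j) ^ 2 := by rw [← pow_mul, pow_succ]
          _ ≤ (x j / L q) ^ 2 := pow_le_pow_left₀ hn ih 2
          _ = x j ^ 2 / L q / L q := by rw [div_pow, sq (L q), div_div]
          _ ≤ x (j + 1) / L q := by
            gcongr
            rw [div_le_iff₀ h0]; linarith [hxs j]
    have : x 0 / L q ≤ 1 := le_one_of_pow_two_pow_le (B := (L 1 + L (q ^ 2)) / 2 / L q)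
      fun j => (hr j).trans (by gcongr; exact hxB j)
    rwa [div_le_one h0] at this

/-- The states of `M`, as functions. -/
def stateSet (M : Set V) : Set (V → ℝ) :=
  {φ | ∃ L : V →ₗ[ℝ] ℝ, NonnegOn M L ∧ L 1 = 1 ∧ ⇑L = φ}

/-- The archimedean bounds confine each value `φ p` to a fixed interval, and being a state is a
pointwise closed condition, so Tychonoff's theorem applies. -/
theorem isCompact_stateSet {M : Set V} (hA : ArchimedeanModule M) : IsCompact (stateSet M) := by
  choose N hN using hA
  have hsub : stateSet M ⊆ Set.pi Set.univ fun p => Set.Icc (-N (-p)) (N p) := by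
    rintro _ ⟨L, hL, h1, rfl⟩ p -
    have e1 := hL _ (hN p)
    have e2 := hL _ (hN (-p))
    simp only [map_sub, map_neg, map_algebraMap, h1] at e1 e2
    exact ⟨by linarith, by linarith⟩
  refine (isCompact_univ_pi fun p => isCompact_Icc).of_isClosed_subset ?_ hsub
  have : stateSet M = (⋂ p : V, ⋂ q : V, {φ | φ (p + q) = φ p + φ q}) ∩
      (⋂ c : ℝ, ⋂ p : V, {φ | φ (c • p) = c * φ p}) ∩ (⋂ p ∈ M, {φ | 0 ≤ φ p}) ∩
      {φ | φ 1 = 1} := by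
    ext φ
    simp only [Set.mem_inter_iff, Set.mem_iInter, Set.mem_ofPred_eq]
    constructor
    · rintro ⟨L, hL, h1, rfl⟩
      exact ⟨⟨⟨by simp, by simp⟩, hL⟩, h1⟩
    · rintro ⟨⟨⟨ha, hs⟩, hp⟩, h1⟩
      exact ⟨⟨⟨φ, ha⟩, hs⟩, hp, h1, rfl⟩
  rw [this]
  refine IsClosed.inter (IsClosed.inter (IsClosed.inter ?_ ?_) ?_) ?_
  · exact isClosed_iInter fun p => isClosed_iInter fun q =>
      isClosed_eq (by fun_prop) (by fun_prop)
  · exact isClosed_iInter fun p => isClosed_iInter fun q =>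
      isClosed_eq (continuous_apply _) (continuous_const.mul (continuous_apply _))
  · exact isClosed_iInter fun p => isClosed_iInter fun q =>
      isClosed_le continuous_const (continuous_apply _)
  · exact isClosed_eq (continuous_apply _) continuous_const

/-- A decomposition of an extreme state into nonnegative functionals is trivial. -/
theorem eq_smul_of_extreme {M : Set V} (hA : ArchimedeanModule M) (h1M : (1 : V) ∈ M)
    {L : V →ₗ[ℝ] ℝ}
    (hext : ⇑L ∈ (stateSet M).extremePoints ℝ) {L₁ L₂ : V →ₗ[ℝ] ℝ} (h₁ : NonnegOn M L₁)
    (h₂ : NonnegOn M L₂) (hsum : L = L₁ + L₂) : L₁ = L₁ 1 • L := by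
  obtain ⟨⟨L', hL', hL1, hLL⟩, hex⟩ := mem_extremePoints.1 hext
  obtain rfl : L' = L := DFunLike.coe_injective hLL
  have hs1 : L₁ 1 + L₂ 1 = 1 := by rw [← hL1, hsum]; rfl
  rcases (h₁ 1 h1M).eq_or_lt with h | ht
  · rw [h₁.eq_zero hA h.symm]; simp
  rcases (h₂ 1 h1M).eq_or_lt with h | ht2
  · have := h₂.eq_zero hA h.symm
    rw [← h, add_zero] at hs1
    rw [hs1, hsum, this]; simp
  have hst : ∀ {ℓ : V →ₗ[ℝ] ℝ}, NonnegOn M ℓ → 0 < ℓ 1 → ⇑((ℓ 1)⁻¹ • ℓ) ∈ stateSet M := by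
    intro ℓ hℓ hpos
    refine ⟨_, fun p hp => ?_, ?_, rfl⟩
    · exact mul_nonneg (inv_nonneg.2 hpos.le) (hℓ p hp)
    · simp [hpos.ne']
  -- `L` is the convex combination, with weights `L₁ 1` and `L₂ 1`, of the two normalized
  -- functionals.
  have := (hex _ (hst h₁ ht) _ (hst h₂ ht2) ⟨L₁ 1, L₂ 1, ht, ht2, hs1, ?_⟩).1
  · have h3 := DFunLike.coe_injective this
    rw [← h3, smul_smul, mul_inv_cancel₀ ht.ne', one_smul]
  · ext p
    simp [hsum, ht.ne', ht2.ne']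

/-- For `1 - d² ∈ M`, both `L(d² ·)` and `L((1 - d²) ·)` are nonnegative on `M` and sum to `L`;
extremality makes the first a multiple of `L`. Scaling gives the rule for all squares, and
polarization for all products. -/
theorem extreme_map_mul {M : Set V} (hM : IsQuadModule M) (hA : ArchimedeanModule M)
    {L : V →ₗ[ℝ] ℝ} (hext : ⇑L ∈ (stateSet M).extremePoints ℝ) (p q : V) :
    L (p * q) = L p * L q := by
  obtain ⟨⟨L', hL, hL1, hLL⟩, -⟩ := mem_extremePoints.1 hext
  obtain rfl : L' = L := DFunLike.coe_injective hLL
  have hsq : ∀ a q : V, L' (a ^ 2 * q) = L' (a ^ 2) * L' q := by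
    intro a q
    obtain ⟨N, hN⟩ := hA (a ^ 2)
    set c : ℝ := max N 1
    have hc : 0 < c := lt_max_of_lt_right one_pos
    have hcM : algebraMap ℝ V c - a ^ 2 ∈ M := by
      have := hM.add_mem hN (hM.algebraMap_mem (c := c - N) (by simp [c]))
      rwa [map_sub, show algebraMap ℝ V N - a ^ 2 + (algebraMap ℝ V c - algebraMap ℝ V N)
        = algebraMap ℝ V c - a ^ 2 by ring] at this
    set d : V := (Real.sqrt c)⁻¹ • a
    have hd2 : d ^ 2 = c⁻¹ • a ^ 2 := by
      simp only [d, smul_pow, inv_pow, Real.sq_sqrt hc.le]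
    have hd : 1 - d ^ 2 ∈ M := by
      have := hM.smul_mem (inv_nonneg.2 hc.le) hcM
      rwa [smul_sub, Algebra.algebraMap_eq_smul_one, smul_smul, inv_mul_cancel₀ hc.ne',
        one_smul, ← hd2] at this
    have key := eq_smul_of_extreme hA hM.one_mem hext
      (L₁ := L' ∘ₗ LinearMap.mulLeft ℝ (d ^ 2)) (L₂ := L' ∘ₗ LinearMap.mulLeft ℝ (1 - d ^ 2))
      (fun p hp => hL _ (hM.sq_mul_mem d hp))
      (fun p hp => by
        have := hL.sq_mul_le hM hd hp
        simp only [LinearMap.comp_apply, LinearMap.mulLeft_apply, sub_mul, one_mul, map_sub]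
        linarith)
      (by ext p; simp [sub_mul])
    have h := LinearMap.congr_fun key q
    simp only [LinearMap.comp_apply, LinearMap.mulLeft_apply, mul_one, hd2, smul_mul_assoc,
      LinearMap.smul_apply, map_smul, smul_eq_mul] at h
    field_simp at h
    exact h
  have h1 := hsq (p + 1) q
  have h2 := hsq p q
  have e1 : (p + 1) ^ 2 * q = p ^ 2 * q + (2 : ℝ) • (p * q) + q := by
    rw [Algebra.smul_def, map_ofNat]; ring
  have e2 : (p + 1) ^ 2 = p ^ 2 + (2 : ℝ) • p + 1 := by
    rw [Algebra.smul_def, map_ofNat]; ring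
  rw [e1, e2] at h1
  simp only [map_add, map_smul, smul_eq_mul, hL1] at h1
  linarith

/-- The cone `s = M - ℝ≥0 f` does not contain `-1`, so `t • 1 ↦ t` is nonnegative on `s` and extends
by M. Riesz's theorem; the archimedean property supplies the cofinality. The extension is a state
and `-f ∈ s`. -/
theorem exists_state_nonpos {M : Set V} (hM : IsQuadModule M) (hA : ArchimedeanModule M)
    {f : V} (hf : f ∉ M) : ∃ φ ∈ stateSet M, φ f ≤ 0 := by
  let s : PointedCone ℝ V :=
    { carrier := {p | ∃ q ∈ M, ∃ c : ℝ, 0 ≤ c ∧ p = q - c • f}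
      add_mem' := by
        rintro _ _ ⟨q, hq, c, hc, rfl⟩ ⟨q', hq', c', hc', rfl⟩
        exact ⟨_, hM.add_mem hq hq', _, add_nonneg hc hc', by rw [add_smul]; abel⟩
      zero_mem' := ⟨0, hM.zero_mem, 0, le_rfl, by simp⟩
      smul_mem' := by
        rintro ⟨t, ht⟩ _ ⟨q, hq, c, hc, rfl⟩
        exact ⟨_, hM.smul_mem ht hq, _, mul_nonneg ht hc, by
          rw [mul_smul, ← smul_sub]; rfl⟩ }
  have hMs : ∀ q ∈ M, q ∈ s := fun q hq => ⟨q, hq, 0, le_rfl, by simp⟩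
  have hneg : (-1 : V) ∉ s := by
    rintro ⟨q, hq, c, hc, h⟩
    have h' : c • f = q + 1 := by rw [eq_sub_iff_add_eq] at h; rw [← sub_eq_zero] at h ⊢
                                  rw [← h]; abel
    rcases hc.eq_or_lt with rfl | hc
    -- Here `-1 ∈ M`, and then the archimedean property puts every element, in particular `f`, into
    -- `M`.
    · rw [zero_smul] at h'
      obtain ⟨N, hN⟩ := hA (-f)
      have hq1 : -1 ∈ M := by rw [eq_neg_of_add_eq_zero_left h'.symm] at hq; exact hq
      apply hf
      have := hM.add_mem hN (hM.smul_mem (abs_nonneg N) hq1)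
      have := hM.add_mem this (hM.algebraMap_mem (sub_nonneg.2 (le_abs_self N)))
      rw [map_sub, smul_neg, ← Algebra.algebraMap_eq_smul_one] at this
      convert this using 1
      abel
    · apply hf
      have := hM.smul_mem (inv_nonneg.2 hc.le) (hM.add_mem hq hM.one_mem)
      rwa [← h', smul_smul, inv_mul_cancel₀ hc.ne', one_smul] at this
  have h10 : (1 : V) ≠ 0 := by
    intro h0
    apply hneg
    rw [h0, neg_zero]; exact s.zero_mem
  obtain ⟨L, hL1, hL⟩ := riesz_extension s (LinearPMap.mkSpanSingleton (1 : V) (1 : ℝ) h10) (by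
    rintro ⟨x, hx⟩ hxs
    obtain ⟨t, rfl⟩ := Submodule.mem_span_singleton.1 hx
    refine ((LinearPMap.mkSpanSingleton'_apply (1 : V) (1 : ℝ) _ t hx).trans (mul_one t)).symm ▸ ?_
    by_contra! ht
    apply hneg
    have := s.smul_mem (show 0 ≤ (-t)⁻¹ by simpa using ht.le) hxs
    have e : ((-t)⁻¹ * t) = -1 := by rw [inv_neg, neg_mul, inv_mul_cancel₀ ht.ne]
    change (-t)⁻¹ • t • (1 : V) ∈ s at this
    rwa [smul_smul, e, neg_one_smul] at this) (by
    intro y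
    obtain ⟨N, hN⟩ := hA (-y)
    refine ⟨⟨algebraMap ℝ V N, Submodule.mem_span_singleton.2
      ⟨N, (Algebra.algebraMap_eq_smul_one N).symm⟩⟩, hMs _ ?_⟩
    simpa using hN)
  have hL1' : L 1 = 1 := by
    have := hL1 ⟨1, Submodule.mem_span_singleton_self _⟩
    rw [this, LinearPMap.mkSpanSingleton_apply]
  refine ⟨L, ⟨L, fun p hp => hL p (hMs p hp), hL1', rfl⟩, ?_⟩
  have := hL (-f) ⟨0, hM.zero_mem, 1, zero_le_one, by simp⟩
  rw [map_neg] at this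
  linarith

/-- Representation theorem for archimedean quadratic modules: an element that is positive at all
algebra homomorphisms to `ℝ` that are nonnegative on `M` lies in `M`. -/
theorem mem_of_forall_algHom_pos {M : Set V} (hM : IsQuadModule M) (hA : ArchimedeanModule M)
    {f : V} (hf : ∀ φ : V →ₐ[ℝ] ℝ, (∀ p ∈ M, 0 ≤ φ p) → 0 < φ f) : f ∈ M := by
  by_contra hfM
  obtain ⟨φ₀, hφ₀, hφ₀f⟩ := exists_state_nonpos hM hA hfM
  have hc := isCompact_stateSet hA
  -- The states minimizing the value at `f` form an exposed compact face; an extreme point of it is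
  -- extreme among all states.
  set ev : StrongDual ℝ (V → ℝ) := -ContinuousLinearMap.proj f with hev
  have hexp : IsExposed ℝ (stateSet M) (ev.toExposed (stateSet M)) :=
    ContinuousLinearMap.toExposed.isExposed
  obtain ⟨ψ, hψ, hmin⟩ := hc.exists_isMaxOn ⟨φ₀, hφ₀⟩ ev.continuous.continuousOn
  obtain ⟨χ, hχ⟩ := (hexp.isCompact hc).extremePoints_nonempty ⟨ψ, hψ, hmin⟩
  have hχe := hexp.isExtreme.extremePoints_subset_extremePoints hχ
  have hχf : χ f ≤ 0 := by
    have := hχ.1.2 φ₀ hφ₀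
    simp [hev] at this
    linarith
  obtain ⟨L, hL, hL1, rfl⟩ := hχe.1
  have := hf (AlgHom.ofLinearMap L hL1 (extreme_map_mul hM hA hχe)) hL
  simp only [AlgHom.ofLinearMap_apply] at this
  linarith

/-- The elements bounded modulo a quadratic module form a subalgebra. -/
def boundedSubalgebra {M : Set V} (hM : IsQuadModule M) : Subalgebra ℝ V where
  carrier := {p | ∃ N : ℝ, 0 < N ∧ algebraMap ℝ V N - p ∈ M ∧ algebraMap ℝ V N + p ∈ M}
  algebraMap_mem' c := by
    refine ⟨|c| + 1, by positivity, ?_, ?_⟩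
    · rw [← map_sub]; exact hM.algebraMap_mem (by linarith [le_abs_self c])
    · rw [← map_add]; exact hM.algebraMap_mem (by linarith [neg_abs_le c])
  add_mem' := by
    rintro p q ⟨N, hN, h1, h2⟩ ⟨N', hN', h1', h2'⟩
    refine ⟨N + N', by positivity, ?_, ?_⟩
    · convert hM.add_mem h1 h1' using 1; rw [map_add]; ring
    · convert hM.add_mem h2 h2' using 1; rw [map_add]; ring
  mul_mem' := by
    have key : ∀ p : V, (∃ N : ℝ, 0 < N ∧ algebraMap ℝ V N - p ∈ M ∧ algebraMap ℝ V N + p ∈ M) →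
        ∃ N : ℝ, 0 < N ∧ algebraMap ℝ V N - p ^ 2 ∈ M := by
      rintro p ⟨N, hN, h1, h2⟩
      refine ⟨N ^ 2, by positivity, ?_⟩
      -- `(N - p)² (N + p) + (N + p)² (N - p) = 2N (N² - p²)`.
      have := hM.smul_mem (c := (2 * N)⁻¹) (by positivity) (hM.add_mem
        (hM.sq_mul_mem (algebraMap ℝ V N - p) h2) (hM.sq_mul_mem (algebraMap ℝ V N + p) h1))
      have e : (algebraMap ℝ V N - p) ^ 2 * (algebraMap ℝ V N + p) +
          (algebraMap ℝ V N + p) ^ 2 * (algebraMap ℝ V N - p)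
          = (2 * N) • (algebraMap ℝ V (N ^ 2) - p ^ 2) := by
        rw [Algebra.smul_def, map_mul, map_ofNat, map_pow]; ring
      rwa [e, smul_smul, inv_mul_cancel₀ (by positivity), one_smul] at this
    rintro p q ⟨N, hN, h1, h2⟩ ⟨N', hN', h1', h2'⟩
    obtain ⟨A, hA, hA'⟩ := key (p + q) ⟨N + N', by positivity,
      by convert hM.add_mem h1 h1' using 1; rw [map_add]; ring,
      by convert hM.add_mem h2 h2' using 1; rw [map_add]; ring⟩
    obtain ⟨B, hB, hB'⟩ := key (p - q) ⟨N + N', by positivity,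
      by convert hM.add_mem h1 h2' using 1; rw [map_add]; ring,
      by convert hM.add_mem h2 h1' using 1; rw [map_add]; ring⟩
    have half : ∀ x y : V, (2 : ℝ) • x = y → x = (2⁻¹ : ℝ) • y := by
      rintro x y rfl; rw [smul_smul]; norm_num
    refine ⟨A + B, by positivity, ?_, ?_⟩
    -- Polarization `4pq = (p + q)² - (p - q)²` reduces products to squares.
    · have e : algebraMap ℝ V (A + B) - p * q = (4⁻¹ : ℝ) • ((algebraMap ℝ V A - (p + q) ^ 2) +
          (p - q) ^ 2) + algebraMap ℝ V (A + B - A / 4) := by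
        have : p * q = (4⁻¹ : ℝ) • ((p + q) ^ 2 - (p - q) ^ 2) := by
          rw [show (p + q) ^ 2 - (p - q) ^ 2 = (4 : ℝ) • (p * q) by
            rw [Algebra.smul_def, map_ofNat]; ring, smul_smul]; norm_num
        rw [this]
        simp only [map_sub, div_eq_inv_mul, map_mul, Algebra.smul_def]
        ring
      rw [e]
      exact hM.add_mem (hM.smul_mem (by norm_num) (hM.add_mem hA' (hM.sq_mem _)))
        (hM.algebraMap_mem (by linarith))
    · have e : algebraMap ℝ V (A + B) + p * q = (4⁻¹ : ℝ) • ((algebraMap ℝ V B - (p - q) ^ 2) +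
          (p + q) ^ 2) + algebraMap ℝ V (A + B - B / 4) := by
        have : p * q = (4⁻¹ : ℝ) • ((p + q) ^ 2 - (p - q) ^ 2) := by
          rw [show (p + q) ^ 2 - (p - q) ^ 2 = (4 : ℝ) • (p * q) by
            rw [Algebra.smul_def, map_ofNat]; ring, smul_smul]; norm_num
        rw [this]
        simp only [map_sub, div_eq_inv_mul, map_mul, Algebra.smul_def]
        ring
      rw [e]
      exact hM.add_mem (hM.smul_mem (by norm_num) (hM.add_mem hB' (hM.sq_mem _)))
        (hM.algebraMap_mem (by linarith))

end QuadraticModules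

/-- A quadratic module of a polynomial ring that contains `R - ‖x‖²` is archimedean. -/
theorem archimedeanModule_of_ball {n : ℕ} {M : Set (MvPolynomial (Fin n) ℝ)}
    (hM : IsQuadModule M) {R : ℝ} (hR : 0 < R) (h : C R - ∑ i, X i ^ 2 ∈ M) :
    ArchimedeanModule M := by
  have htop : boundedSubalgebra hM = ⊤ := by
    rw [eq_top_iff, ← MvPolynomial.adjoin_range_X, Algebra.adjoin_le_iff]
    rintro _ ⟨i, rfl⟩
    have hsum : ∀ s : Finset (Fin n), ∑ j ∈ s, (X j : MvPolynomial (Fin n) ℝ) ^ 2 ∈ M := by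
      intro s
      induction s using Finset.induction_on with
      | empty => simpa using hM.zero_mem
      | insert j s hj ih => rw [Finset.sum_insert hj]; exact hM.add_mem (hM.sq_mem _) ih
    have hi : C R - X i ^ 2 ∈ M := by
      have := hM.add_mem h (hsum (Finset.univ.erase i))
      rwa [← Finset.add_sum_erase _ _ (Finset.mem_univ i), ← sub_sub, sub_add_cancel] at this
    have hC : (2 : MvPolynomial (Fin n) ℝ) * C (1 / 2) = 1 := by
      rw [← map_ofNat (C : ℝ →+* MvPolynomial (Fin n) ℝ) 2, ← C_mul]; norm_num
    -- Completing the square: `R + 1/4 ∓ X i = (R - X i ^ 2) + (X i ∓ 1/2) ^ 2`.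
    refine ⟨R + 1 / 4, by positivity, ?_, ?_⟩
    · convert hM.add_mem hi (hM.sq_mem (X i - C (1 / 2))) using 1
      rw [algebraMap_eq, C_add, show (1 / 4 : ℝ) = 1 / 2 * (1 / 2) by norm_num, C_mul]
      linear_combination (X i) * hC
    · convert hM.add_mem hi (hM.sq_mem (X i + C (1 / 2))) using 1
      rw [algebraMap_eq, C_add, show (1 / 4 : ℝ) = 1 / 2 * (1 / 2) by norm_num, C_mul]
      linear_combination -(X i) * hC
  intro p
  have : p ∈ boundedSubalgebra hM := htop ▸ Algebra.mem_top
  obtain ⟨N, -, hN, -⟩ := this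
  exact ⟨N, hN⟩

/-! ### Separation of convex cones and Richter's theorem -/

section ConvexGeometry

variable {E : Type*} [NormedAddCommGroup E] [NormedSpace ℝ E] [FiniteDimensional ℝ E]

/-- A spanning cone has interior points. Separating the open interior from `y` is strict there, so
the functional cannot vanish on all of `D`. -/
theorem exists_separating_of_span_eq_top (D : PointedCone ℝ E)
    (hspan : Submodule.span ℝ (D : Set E) = ⊤) {y : E} (hy : y ∉ D) :
    ∃ ℓ : E →ₗ[ℝ] ℝ, (∀ c ∈ D, 0 ≤ ℓ c) ∧ ℓ y ≤ 0 ∧ ∃ c ∈ D, ℓ c ≠ 0 := by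
  have hconv : Convex ℝ (D : Set E) := D.convex
  have haff : affineSpan ℝ (D : Set E) = ⊤ := by
    have := affineSpan_insert_zero (k := ℝ) (D : Set E)
    rw [Set.insert_eq_of_mem D.zero_mem, hspan] at this
    exact SetLike.coe_injective (by simpa using this)
  have hint : (interior (D : Set E)).Nonempty := hconv.interior_nonempty_iff_affineSpan_eq_top.2 haff
  obtain ⟨f, hf⟩ := geometric_hahn_banach_open_point hconv.interior isOpen_interior
    (fun h => hy (interior_subset h))
  have hle : ∀ c ∈ D, f c ≤ f y := by
    intro c hc
    have hc' : c ∈ closure (interior (D : Set E)) := by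
      rw [hconv.closure_interior_eq_closure_of_nonempty_interior hint]
      exact subset_closure hc
    exact closure_minimal (fun a ha => (hf a ha).le)
      (isClosed_le f.continuous continuous_const) hc'
  have hfy : 0 ≤ f y := by simpa using hle 0 D.zero_mem
  have hneg : ∀ c ∈ D, f c ≤ 0 := by
    intro c hc
    by_contra! hpos
    have := hle _ (D.smul_mem (show 0 ≤ (f y + 1) / f c by positivity) hc)
    change f (((f y + 1) / f c) • c) ≤ f y at this
    rw [map_smul, smul_eq_mul, div_mul_cancel₀ _ hpos.ne'] at this
    linarith
  refine ⟨-f.toLinearMap, fun c hc => by simpa using hneg c hc, by simpa using hfy, ?_⟩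
  by_contra! h0
  have hker : Submodule.span ℝ (D : Set E) ≤ LinearMap.ker f.toLinearMap :=
    Submodule.span_le.2 fun c hc => by simpa using h0 c hc
  rw [hspan] at hker
  obtain ⟨x, hx⟩ := hint
  have e1 : f x = 0 := hker (x := x) trivial
  have e2 : f y = 0 := hker (x := y) trivial
  have := hf x hx
  linarith

/-- Weak separation of a point from a (not necessarily closed) convex cone, such that the
separating functional does not vanish on the cone. -/
theorem exists_separating_of_mem_span (D : PointedCone ℝ E) {y : E}
    (hyS : y ∈ Submodule.span ℝ (D : Set E)) (hy : y ∉ D) :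
    ∃ ℓ : E →ₗ[ℝ] ℝ, (∀ c ∈ D, 0 ≤ ℓ c) ∧ ℓ y ≤ 0 ∧ ∃ c ∈ D, ℓ c ≠ 0 := by
  set S := Submodule.span ℝ (D : Set E)
  obtain ⟨ℓ, h1, h2, c, hc, h3⟩ := exists_separating_of_span_eq_top (E := S)
    (PointedCone.comap S.subtype D)
    (by
      have := Submodule.span_span_coe_preimage (R := ℝ) (s := (D : Set E))
      exact this)
    (y := ⟨y, hyS⟩) hy
  obtain ⟨L, hL⟩ := LinearMap.exists_extend ℓ
  have hLℓ : ∀ (x : E) (hx : x ∈ S), L x = ℓ ⟨x, hx⟩ := fun x hx => by rw [← hL]; rfl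
  refine ⟨L, fun x hx => ?_, ?_, c, hc, ?_⟩
  · rw [hLℓ x (Submodule.subset_span hx)]; exact h1 _ hx
  · rwa [hLℓ y hyS]
  · rw [hLℓ c c.2]; exact h3

/-- Richter's theorem: a vector integral lies in the convex cone generated by the values of the
integrand. The measure may be infinite. -/
theorem integral_mem_cone {Ω : Type*} [MeasurableSpace Ω] {μ : Measure Ω} {v : Ω → E}
    (hv : Integrable v μ) {K : Set Ω} (hK : μ Kᶜ = 0) :
    ∫ u, v u ∂μ ∈ PointedCone.hull ℝ (v '' K) := by
  induction hd : Module.finrank ℝ (Submodule.span ℝ (v '' K)) using Nat.strong_induction_on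
    generalizing K with
  | _ d ih =>
  set D : PointedCone ℝ E := PointedCone.hull ℝ (v '' K) with hD
  have hint : ∀ ℓ : E →ₗ[ℝ] ℝ, ∫ u, ℓ (v u) ∂μ = ℓ (∫ u, v u ∂μ) := fun ℓ =>
    (LinearMap.toContinuousLinearMap ℓ).integral_comp_comm hv
  have hKae : ∀ᵐ u ∂μ, u ∈ K := hK
  by_contra hy
  have hspan : Submodule.span ℝ (D : Set E) = Submodule.span ℝ (v '' K) :=
    Submodule.span_span_of_tower _ _ _
  have hyS : ∫ u, v u ∂μ ∈ Submodule.span ℝ (D : Set E) := by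
    rw [hspan]
    by_contra hn
    obtain ⟨ℓ, h1, h2⟩ := Submodule.exists_le_ker_of_notMem hn
    apply h1
    rw [← hint]
    refine integral_eq_zero_of_ae ?_
    filter_upwards [hKae] with u hu
    exact h2 (Submodule.subset_span ⟨u, hu, rfl⟩)
  -- `ℓ ∘ v` is a.e. nonnegative with integral at most `0`, hence a.e. zero. Shrinking `K` to its
  -- zero set keeps full measure and lowers the dimension of the span, because `ℓ` is nonzero on
  -- `D`.
  obtain ⟨ℓ, h1, h2, c, hc, h3⟩ := exists_separating_of_mem_span D hyS hy
  have hnn : 0 ≤ᵐ[μ] fun u => ℓ (v u) := by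
    filter_upwards [hKae] with u hu
    exact h1 _ (Submodule.subset_span ⟨u, hu, rfl⟩)
  have hz : (fun u => ℓ (v u)) =ᵐ[μ] 0 := by
    rw [← integral_eq_zero_iff_of_nonneg_ae hnn
      ((LinearMap.toContinuousLinearMap ℓ).integrable_comp hv)]
    exact le_antisymm (hint ℓ ▸ h2) (integral_nonneg_of_ae hnn)
  set K' := {u ∈ K | ℓ (v u) = 0} with hK'
  have hsub : K' ⊆ K := Set.sep_subset _ _
  have hK'0 : μ K'ᶜ = 0 := by
    have : ∀ᵐ u ∂μ, u ∈ K' := by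
      filter_upwards [hKae, hz] with u hu hu'
      exact ⟨hu, hu'⟩
    exact this
  have hker : Submodule.span ℝ (v '' K') ≤ LinearMap.ker ℓ :=
    Submodule.span_le.2 (by rintro _ ⟨u, hu, rfl⟩; exact hu.2)
  have hlt : Submodule.span ℝ (v '' K') < Submodule.span ℝ (v '' K) := by
    refine lt_of_le_of_ne (Submodule.span_mono (Set.image_mono hsub)) fun heq => h3 ?_
    rw [heq, ← hspan] at hker
    exact hker (Submodule.subset_span hc)
  have := ih _ (hd ▸ Submodule.finrank_lt_finrank_of_lt hlt) hK'0 rfl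
  exact hy (Submodule.span_mono (Set.image_mono hsub) this)

/-- By Carathéodory, at most `dim E + 1` points suffice, so the hull is a finite union of continuous
images of compact sets. -/
theorem isCompact_convexHull {T : Set E} (hT : IsCompact T) : IsCompact (convexHull ℝ T) := by
  have : convexHull ℝ T = ⋃ k ∈ Finset.range (Module.finrank ℝ E + 2),
      (fun p : (Fin k → ℝ) × (Fin k → E) => ∑ i, p.1 i • p.2 i) ''
        (stdSimplex ℝ (Fin k) ×ˢ Set.pi Set.univ fun _ => T) := by
    ext x
    simp only [Set.mem_iUnion, Finset.mem_range]
    constructor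
    · intro hx
      obtain ⟨ι, _, z, w, hz, haff, hw, hw1, rfl⟩ := eq_pos_convex_span_of_mem_convexHull hx
      have hcard := (haff.card_le_finrank_succ).trans
        (Nat.succ_le_succ (Submodule.finrank_le _))
      have e := (Fintype.equivFin ι).symm
      refine ⟨Fintype.card ι, by omega, (fun i => w (e i), fun i => z (e i)), ⟨⟨?_, ?_⟩, ?_⟩, ?_⟩
      · exact fun i => (hw _).le
      · rw [← hw1]; exact e.sum_comp w
      · exact fun i _ => hz ⟨_, rfl⟩
      · exact e.sum_comp fun i => w i • z i
    · rintro ⟨k, -, ⟨w, z⟩, ⟨⟨hw, hw1⟩, hz⟩, rfl⟩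
      exact (convex_convexHull ℝ T).sum_mem (fun i _ => hw i) hw1
        fun i _ => subset_convexHull ℝ T (hz i trivial)
  rw [this]
  refine (Finset.range _).isCompact_biUnion fun k _ => ?_
  exact ((isCompact_stdSimplex ℝ (Fin k)).prod (isCompact_univ_pi fun _ => hT)).image (by fun_prop)

/-- Strict separation of a point from the cone generated by a compact subset of an open
half space. -/
theorem exists_pos_of_notMem_cone {T : Set E} (hT : IsCompact T) (c : E →ₗ[ℝ] ℝ)
    (hc : ∀ t ∈ T, 0 < c t) {b : E} (hb : b ∉ PointedCone.hull ℝ T) :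
    ∃ ℓ : E →ₗ[ℝ] ℝ, (∀ t ∈ T, 0 < ℓ t) ∧ ℓ b < 0 := by
  set D : PointedCone ℝ E := PointedCone.hull ℝ T
  have hconv : Convex ℝ (D : Set E) := D.convex
  have hTD : convexHull ℝ T ⊆ D := convexHull_min Submodule.subset_span hconv
  have hTc : ∀ t ∈ convexHull ℝ T, 0 < c t := fun t ht =>
    convexHull_min (t := {t | 0 < c t}) hc (convex_halfSpace_gt c.isLinear 0) ht
  have hb0 : b ≠ 0 := by rintro rfl; exact hb D.zero_mem
  set ray : Set E := (fun s : ℝ => s • b) '' Set.Ici 0 with hray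
  have hrayc : IsClosed ray := by
    exact (isClosedEmbedding_smul_left hb0).isClosedMap _ isClosed_Ici
  have hrayv : Convex ℝ ray := (convex_Ici (0 : ℝ)).linear_image (LinearMap.toSpanSingleton ℝ E b)
  have hdisj : Disjoint (convexHull ℝ T) ray := by
    rw [Set.disjoint_left]
    rintro _ hx ⟨s, hs, rfl⟩
    rcases (Set.mem_Ici.1 hs).eq_or_lt with rfl | hs
    · have := hTc _ hx
      simp at this
    · apply hb
      have := D.smul_mem (inv_nonneg.2 hs.le) (hTD hx)
      change s⁻¹ • s • b ∈ D at this
      rwa [smul_smul, inv_mul_cancel₀ hs.ne', one_smul] at this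
  obtain ⟨f, u, v, h1, h2, h3⟩ := geometric_hahn_banach_compact_closed (convex_convexHull ℝ T)
    (isCompact_convexHull hT) hrayv hrayc hdisj
  have hv0 : v < 0 := by simpa using h3 0 ⟨0, by simp, by simp⟩
  have hfb : 0 ≤ f b := by
    by_contra! hneg
    have := h3 ((v / f b) • b) ⟨_, div_nonneg_of_nonpos hv0.le hneg.le, rfl⟩
    rw [map_smul, smul_eq_mul, div_mul_cancel₀ _ hneg.ne] at this
    exact lt_irrefl _ this
  -- So far only `-f b ≤ 0`. Subtracting a small multiple of `e`, where `e b > 0`, makes this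
  -- strict; `δ` is small enough to preserve positivity on `T`, where `-f > -u > 0`.
  obtain ⟨e, -, he⟩ := exists_dual_vector ℝ b (norm_ne_zero_iff.2 hb0)
  have heb : 0 < e b := by rw [he]; simpa using hb0
  obtain ⟨B, hB⟩ := hT.bddAbove_image (f := e) e.continuous.continuousOn
  set δ : ℝ := -u / (|B| + 1)
  have hu : 0 < -u := by linarith
  have hδ : 0 < δ := by positivity
  refine ⟨-f.toLinearMap - δ • e.toLinearMap, fun t ht => ?_, ?_⟩
  · have e1 := h1 t (subset_convexHull ℝ T ht)
    have e2 : e t ≤ |B| := (hB ⟨t, ht, rfl⟩).trans (le_abs_self B)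
    have e3 : δ * e t ≤ -u := by
      calc δ * e t ≤ δ * (|B| + 1) := by gcongr; linarith
        _ = -u := div_mul_cancel₀ _ (by positivity)
    simp only [LinearMap.sub_apply, LinearMap.neg_apply, LinearMap.smul_apply, smul_eq_mul,
      ContinuousLinearMap.coe_coe]
    linarith
  · simp only [LinearMap.sub_apply, LinearMap.neg_apply, LinearMap.smul_apply, smul_eq_mul,
      ContinuousLinearMap.coe_coe]
    have := mul_pos hδ heb
    linarith

end ConvexGeometry

/-! ### Leading forms of nonnegative polynomials -/

section SumsOfSquares

variable {n : ℕ}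

theorem IsSumSq.eval_nonneg {s : MvPolynomial (Fin n) ℝ} (hs : IsSumSq s) (u : Fin n → ℝ) :
    0 ≤ eval u s := by
  induction hs with
  | zero => simp
  | sq_add a _ ih => rw [map_add, map_mul]; exact add_nonneg (mul_self_nonneg _) ih

/-- The leading form of a nonnegative polynomial is nonnegative. -/
theorem eval_homogeneousComponent_nonneg {p : MvPolynomial (Fin n) ℝ} (hp : ∀ u, 0 ≤ eval u p)
    (u : Fin n → ℝ) : 0 ≤ eval u (homogeneousComponent p.totalDegree p) := by
  set d := p.totalDegree with hd
  -- `F s = s ^ d * p(u / s)` for `s > 0`; it extends continuously to `s = 0` with the leading form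
  -- as value.
  set F : ℝ → ℝ := fun s => ∑ i ∈ Finset.range (d + 1), s ^ (d - i) *
    eval u (homogeneousComponent i p) with hF
  have hF0 : F 0 = eval u (homogeneousComponent d p) := by
    rw [hF]
    dsimp only
    rw [Finset.sum_range_succ, Finset.sum_eq_zero]
    · simp
    · intro i hi
      have : d - i ≠ 0 := by have := Finset.mem_range.1 hi; omega
      simp [this]
  have hpos : ∀ s : ℝ, 0 < s → 0 ≤ F s := by
    intro s hs
    have : F s = s ^ d * eval (fun j => s⁻¹ * u j) p := by
      conv_rhs => rw [← sum_homogeneousComponent p, map_sum, Finset.mul_sum, ← hd]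
      refine Finset.sum_congr rfl fun i hi => ?_
      have hi' : i ≤ d := Nat.lt_succ_iff.1 (Finset.mem_range.1 hi)
      have hh : eval (fun j => s⁻¹ * u j) (homogeneousComponent i p)
          = s⁻¹ ^ i * eval u (homogeneousComponent i p) := by
        rw [eval_eq', eval_eq', Finset.mul_sum]
        refine Finset.sum_congr rfl fun α hα => ?_
        have hα' : ∑ j, α j = i := by
          rw [mem_support_iff, coeff_homogeneousComponent] at hα
          rw [← Finsupp.degree_eq_sum]
          by_contra hne
          exact hα (if_neg hne)
        simp only [mul_pow, Finset.prod_mul_distrib, Finset.prod_pow_eq_pow_sum, hα']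
        ring
      rw [hh, ← mul_assoc, inv_pow, ← div_eq_mul_inv, pow_sub₀ _ hs.ne' hi', div_eq_mul_inv]
    rw [this]
    exact mul_nonneg (pow_nonneg hs.le _) (hp _)
  have hcont : Continuous F := by fun_prop
  rw [← hF0]
  exact ge_of_tendsto ((hcont.tendsto 0).mono_left (nhdsWithin_le_nhds (s := Set.Ioi 0)))
    (by filter_upwards [self_mem_nhdsWithin] with s hs using hpos s hs)

theorem homogeneousComponent_totalDegree_ne_zero {p : MvPolynomial (Fin n) ℝ} (hp : p ≠ 0) :
    homogeneousComponent p.totalDegree p ≠ 0 := by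
  obtain ⟨α, hα, hdeg⟩ := Finset.exists_mem_eq_sup p.support (support_nonempty.2 hp)
    (fun s => s.sum fun _ e => e)
  intro h0
  have := congrArg (coeff α) h0
  rw [coeff_homogeneousComponent, if_pos, coeff_zero] at this
  · exact mem_support_iff.1 hα this
  · exact hdeg.symm

/-- There is no cancellation of leading forms in a sum of nonnegative polynomials. -/
theorem totalDegree_le_of_nonneg {p q : MvPolynomial (Fin n) ℝ} (hp : ∀ u, 0 ≤ eval u p)
    (hq : ∀ u, 0 ≤ eval u q) : p.totalDegree ≤ (p + q).totalDegree := by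
  by_contra! hlt
  have hdeg : q.totalDegree = p.totalDegree := by
    rcases lt_trichotomy q.totalDegree p.totalDegree with h | h | h
    · rw [totalDegree_add_eq_left_of_totalDegree_lt h] at hlt; omega
    · exact h
    · rw [totalDegree_add_eq_right_of_totalDegree_lt h] at hlt; omega
  have hp0 : p ≠ 0 := by rintro rfl; simp at hlt
  apply homogeneousComponent_totalDegree_ne_zero hp0
  have hsum := homogeneousComponent_eq_zero _ _ hlt
  rw [map_add] at hsum
  refine MvPolynomial.funext fun u => ?_
  have e1 := eval_homogeneousComponent_nonneg hp u
  have e2 := eval_homogeneousComponent_nonneg hq u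
  rw [hdeg] at e2
  have e3 := congrArg (eval u) hsum
  rw [map_add, map_zero] at e3
  rw [map_zero]
  linarith

end SumsOfSquares

/-! ### The Riesz pairing and point evaluations -/

section Riesz

variable {n : ℕ}

theorem degree_le_totalDegree {p : MvPolynomial (Fin n) ℝ} {α : Fin n →₀ ℕ} (h : α ∈ p.support) :
    α.degree ≤ p.totalDegree := le_totalDegree h

theorem totalDegree_monomial_one (α : Fin n →₀ ℕ) :
    (monomial α (1 : ℝ)).totalDegree = α.degree := totalDegree_monomial α one_ne_zero

theorem support_subset_expLE {p : MvPolynomial (Fin n) ℝ} {d : ℕ} (h : p.totalDegree ≤ d) :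
    p.support ⊆ expLE n d := fun _ hα => mem_expLE.2 ((degree_le_totalDegree hα).trans h)

theorem support_subset_of_mem_polysOn {A : Finset (Fin n →₀ ℕ)} {p : MvPolynomial (Fin n) ℝ}
    (hp : p ∈ polysOn A) : p.support ⊆ A := by
  induction hp using Submodule.span_induction with
  | mem x hx =>
    obtain ⟨α, hα, rfl⟩ := hx
    intro β hβ
    have := support_monomial_subset hβ
    rw [Finset.mem_singleton] at this
    exact this ▸ hα
  | zero => simp
  | add p q _ _ hp hq => classical exact support_add.trans (Finset.union_subset hp hq)
  | smul c p _ hp => exact support_smul.trans hp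

/-- The Riesz pairing is linear in the polynomial. -/
def rieszLin {A : Finset (Fin n →₀ ℕ)} (y : A → ℝ) : MvPolynomial (Fin n) ℝ →ₗ[ℝ] ℝ where
  toFun p := riesz p y
  map_add' p q := by simp [riesz, add_mul, Finset.sum_add_distrib]
  map_smul' c p := by simp [riesz, Finset.mul_sum, mul_assoc]

theorem rieszLin_apply {A : Finset (Fin n →₀ ℕ)} (y : A → ℝ) (p : MvPolynomial (Fin n) ℝ) :
    rieszLin y p = riesz p y := rfl

theorem riesz_add_right {A : Finset (Fin n →₀ ℕ)} (p : MvPolynomial (Fin n) ℝ) (y z : A → ℝ) :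
    riesz p (y + z) = riesz p y + riesz p z := by
  simp [riesz, mul_add, Finset.sum_add_distrib]

theorem riesz_smul_right {A : Finset (Fin n →₀ ℕ)} (p : MvPolynomial (Fin n) ℝ) (c : ℝ)
    (y : A → ℝ) : riesz p (c • y) = c * riesz p y := by
  simp [riesz, Finset.mul_sum, mul_left_comm]

theorem riesz_eq_sum_support {A : Finset (Fin n →₀ ℕ)} {p : MvPolynomial (Fin n) ℝ}
    (hp : p.support ⊆ A) {y : A → ℝ} {f : (Fin n →₀ ℕ) → ℝ} (hf : ∀ α : A, f α = y α) :
    riesz p y = ∑ α ∈ p.support, p.coeff α * f α := by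
  have : riesz p y = ∑ α ∈ A, p.coeff α * f α := by
    rw [← Finset.sum_coe_sort A]
    exact Finset.sum_congr rfl fun α _ => by rw [hf]
  rw [this]
  refine (Finset.sum_subset hp fun α _ hα => ?_).symm
  rw [notMem_support_iff.1 hα, zero_mul]

theorem riesz_eq_of_restrict {A B : Finset (Fin n →₀ ℕ)} (hAB : A ⊆ B)
    {p : MvPolynomial (Fin n) ℝ} (hp : p.support ⊆ A) {y : A → ℝ} {w : B → ℝ}
    (h : ∀ (α : A) (hα : (α : Fin n →₀ ℕ) ∈ B), y α = w ⟨α, hα⟩) : riesz p y = riesz p w := by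
  classical
  set f : (Fin n →₀ ℕ) → ℝ := fun α => if hα : α ∈ B then w ⟨α, hα⟩ else 0
  have hf : ∀ α : B, f α = w α := fun α => dif_pos α.2
  rw [riesz_eq_sum_support hp (f := f) fun α => (hf ⟨α, hAB α.2⟩).trans (h α (hAB α.2)).symm,
    riesz_eq_sum_support (hp.trans hAB) hf]

/-- The vector of the monomials with exponents in `A` at the point `u`. -/
def pointVec (A : Finset (Fin n →₀ ℕ)) (u : Fin n → ℝ) : A → ℝ :=
  fun α => ∏ i, u i ^ (α : Fin n →₀ ℕ) i

theorem riesz_pointVec {A : Finset (Fin n →₀ ℕ)} {p : MvPolynomial (Fin n) ℝ}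
    (hp : p.support ⊆ A) (u : Fin n → ℝ) : riesz p (pointVec A u) = eval u p := by
  rw [riesz_eq_sum_support hp (y := pointVec A u) (f := fun α => ∏ i, u i ^ α i) fun _ => rfl,
    eval_eq']

end Riesz

/-! ### Localizing matrices on truncated modules and ideals -/

section Localizing

variable {n : ℕ}

theorem degree_le_of_mem_locIndex {q : MvPolynomial (Fin n) ℝ} {k : ℕ} (α : locIndex q k) :
    q.totalDegree + 2 * (α : Fin n →₀ ℕ).degree ≤ 2 * k := (Finset.mem_filter.1 α.2).2

theorem mem_locIndex {q : MvPolynomial (Fin n) ℝ} {k : ℕ} {α : Fin n →₀ ℕ}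
    (h : q.totalDegree + 2 * α.degree ≤ 2 * k) : α ∈ locIndex q k :=
  Finset.mem_filter.2 ⟨mem_expLE.2 (by omega), h⟩

theorem locMatrix_add (q : MvPolynomial (Fin n) ℝ) (k : ℕ) (w w' : expLE n (2 * k) → ℝ) :
    locMatrix q k (w + w') = locMatrix q k w + locMatrix q k w' := by
  ext α β; exact riesz_add_right _ _ _

theorem locMatrix_smul (q : MvPolynomial (Fin n) ℝ) (k : ℕ) (c : ℝ) (w : expLE n (2 * k) → ℝ) :
    locMatrix q k (c • w) = c • locMatrix q k w := by
  ext α β; exact riesz_smul_right _ _ _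

theorem eval_monomial_add (u : Fin n → ℝ) (α β : Fin n →₀ ℕ) :
    eval u (monomial (α + β) (1 : ℝ)) = (∏ i, u i ^ α i) * ∏ i, u i ^ β i := by
  rw [eval_monomial, one_mul, Finsupp.prod_fintype _ _ (by simp), ← Finset.prod_mul_distrib]
  exact Finset.prod_congr rfl fun i _ => by rw [Finsupp.add_apply, pow_add]

/-- Localizing matrices of point evaluations have rank one. -/
theorem locMatrix_pointVec (q : MvPolynomial (Fin n) ℝ) (k : ℕ) (u : Fin n → ℝ) :
    locMatrix q k (pointVec _ u) = eval u q •
      Matrix.vecMulVec (pointVec (locIndex q k) u) (star (pointVec (locIndex q k) u)) := by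
  ext α β
  have hd : (q * monomial ((α : Fin n →₀ ℕ) + (β : Fin n →₀ ℕ)) 1).totalDegree ≤ 2 * k := by
    refine (totalDegree_mul _ _).trans ?_
    rw [totalDegree_monomial_one, map_add]
    have := degree_le_of_mem_locIndex α
    have := degree_le_of_mem_locIndex β
    omega
  rw [locMatrix, riesz_pointVec (support_subset_expLE hd), map_mul, eval_monomial_add]
  simp [Matrix.vecMulVec_apply, pointVec]

theorem posSemidef_locMatrix_pointVec {q : MvPolynomial (Fin n) ℝ} (k : ℕ) {u : Fin n → ℝ}
    (hu : 0 ≤ eval u q) : (locMatrix q k (pointVec _ u)).PosSemidef := by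
  rw [locMatrix_pointVec]
  exact (Matrix.posSemidef_vecMulVec_self_star _).smul hu

/-- The quadratic form of the localizing matrix. -/
theorem riesz_mul_sq_nonneg {q p : MvPolynomial (Fin n) ℝ} {k : ℕ} {w : expLE n (2 * k) → ℝ}
    (hw : (locMatrix q k w).PosSemidef) (hd : (q * (p * p)).totalDegree ≤ 2 * k) :
    0 ≤ riesz (q * (p * p)) w := by
  -- A zero product has degree `0` and would give no bound on the degree of `p`.
  by_cases h0 : q * (p * p) = 0
  · rw [h0]; simp [riesz]
  have hq : q ≠ 0 := left_ne_zero_of_mul h0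
  have hpp : p * p ≠ 0 := right_ne_zero_of_mul h0
  have hp : p ≠ 0 := left_ne_zero_of_mul hpp
  rw [totalDegree_mul_of_isDomain hq hpp, totalDegree_mul_of_isDomain hp hp] at hd
  have hsupp : p.support ⊆ locIndex q k := fun α hα =>
    mem_locIndex (by have := degree_le_totalDegree hα; omega)
  have hp_eq : p = ∑ α : locIndex q k, p.coeff (α : Fin n →₀ ℕ) • monomial (α : Fin n →₀ ℕ) 1 := by
    rw [Finset.sum_coe_sort (locIndex q k) fun α => p.coeff α • monomial α (1 : ℝ),
      ← Finset.sum_subset hsupp fun α _ hα => by rw [notMem_support_iff.1 hα, zero_smul]]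
    conv_lhs => rw [p.as_sum]
    exact Finset.sum_congr rfl fun α _ => by rw [smul_monomial, smul_eq_mul, mul_one]
  have hexp : q * (p * p) = ∑ α : locIndex q k, ∑ β : locIndex q k,
      (p.coeff (α : Fin n →₀ ℕ) * p.coeff (β : Fin n →₀ ℕ)) •
        (q * monomial ((α : Fin n →₀ ℕ) + (β : Fin n →₀ ℕ)) 1) := by
    conv_lhs => rw [hp_eq]
    rw [Finset.sum_mul_sum, Finset.mul_sum]
    refine Finset.sum_congr rfl fun α _ => ?_
    rw [Finset.mul_sum]
    refine Finset.sum_congr rfl fun β _ => ?_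
    rw [smul_mul_smul_comm, monomial_mul, one_mul, mul_smul_comm]
  have := hw.dotProduct_mulVec_nonneg fun α => p.coeff (α : Fin n →₀ ℕ)
  refine this.trans_eq (Eq.symm ?_)
  rw [hexp, ← rieszLin_apply, map_sum]
  simp only [map_sum, map_smul, rieszLin_apply, dotProduct, Matrix.mulVec, star_trivial, smul_eq_mul,
    Finset.mul_sum, locMatrix]
  exact Finset.sum_congr rfl fun α _ => Finset.sum_congr rfl fun β _ => by ring

/-- Squares cannot cancel in top degree, so each summand obeys the degree bound of the sum and can
be tested separately. -/
theorem riesz_mul_sumSq_nonneg {q s : MvPolynomial (Fin n) ℝ} {k : ℕ} {w : expLE n (2 * k) → ℝ}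
    (hw : (locMatrix q k w).PosSemidef) (hs : IsSumSq s) (hd : (q * s).totalDegree ≤ 2 * k) :
    0 ≤ riesz (q * s) w := by
  induction hs with
  | zero => simp [riesz]
  | sq_add a hs ih =>
    rename_i s
    by_cases h0 : q * (a * a + s) = 0
    · rw [h0]; simp [riesz]
    rw [totalDegree_mul_of_isDomain (left_ne_zero_of_mul h0) (right_ne_zero_of_mul h0)] at hd
    have ha : ∀ u, 0 ≤ eval u (a * a) := fun u => by rw [map_mul]; exact mul_self_nonneg _
    have h1 := totalDegree_le_of_nonneg ha (IsSumSq.eval_nonneg hs)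
    have h2 := totalDegree_le_of_nonneg (IsSumSq.eval_nonneg hs) ha
    rw [add_comm s] at h2
    rw [mul_add, ← rieszLin_apply, map_add]
    exact add_nonneg
      (riesz_mul_sq_nonneg hw ((totalDegree_mul _ _).trans (by omega)))
      (ih ((totalDegree_mul _ _).trans (by omega)))

theorem riesz_mul_eq_zero {q p : MvPolynomial (Fin n) ℝ} {k k' : ℕ}
    {w : expLE n (2 * k') → ℝ} (hw : locMatrix q k' w = 0)
    (hd : (q * p).totalDegree ≤ 2 * k) (hk : k ≤ k') (hk' : k < k' ∨ Even q.totalDegree) :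
    riesz (q * p) w = 0 := by
  by_cases h0 : q * p = 0
  · rw [h0]; simp [riesz]
  rw [totalDegree_mul_of_isDomain (left_ne_zero_of_mul h0) (right_ne_zero_of_mul h0)] at hd
  have hexp : q * p = ∑ γ ∈ p.support, p.coeff γ • (q * monomial γ 1) := by
    conv_lhs => rw [p.as_sum]
    rw [Finset.mul_sum]
    exact Finset.sum_congr rfl fun γ _ => by
      rw [← mul_smul_comm, smul_monomial, smul_eq_mul, mul_one]
  rw [hexp, ← rieszLin_apply, map_sum]
  refine Finset.sum_eq_zero fun γ hγ => ?_
  have hγ' := degree_le_totalDegree hγ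
  -- Each `q x^γ` is matched to the matrix entry `(α, β)` with `γ = α + β` split as evenly as
  -- possible. The larger half needs `deg q + 2⌈|γ|/2⌉ ≤ 2k'`. For odd `|γ|` this costs one extra
  -- degree, covered by `k < k'` or, if `deg q` is even, by parity.
  obtain ⟨α, hα, hαd⟩ := γ.exists_le_degree_eq (γ.degree / 2) (by omega)
  obtain ⟨β, rfl⟩ := le_iff_exists_add.1 hα
  have hsum : (α + β).degree = α.degree + β.degree := map_add _ _ _
  have hev : q.totalDegree + 2 * β.degree ≤ 2 * k' := by
    rcases hk' with h | ⟨r, hr⟩ <;> omega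
  have := congrFun (congrFun hw ⟨α, mem_locIndex (by omega)⟩) ⟨β, mem_locIndex hev⟩
  rw [map_smul, rieszLin_apply]
  change riesz (q * monomial (α + β) 1) w = 0 at this
  rw [this, smul_zero]

end Localizing

/-! ### Putinar's Positivstellensatz -/

section Putinar

variable {n m₁ m₂ : ℕ}

theorem mem_quadModule_iff {g : Fin m₂ → MvPolynomial (Fin n) ℝ} {q : MvPolynomial (Fin n) ℝ} :
    q ∈ quadModule g ↔ ∃ (s₀ : MvPolynomial (Fin n) ℝ) (s : Fin m₂ → MvPolynomial (Fin n) ℝ),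
      IsSumSq s₀ ∧ (∀ j, IsSumSq (s j)) ∧ q = s₀ + ∑ j, g j * s j := by
  constructor
  · intro hq
    obtain ⟨k, s₀, s, h0, -, hs, rfl⟩ := Set.mem_iUnion.1 hq
    exact ⟨s₀, s, h0, fun j => (hs j).1, rfl⟩
  · rintro ⟨s₀, s, h0, hs, rfl⟩
    refine Set.mem_iUnion.2 ⟨s₀.totalDegree + Finset.univ.sup fun j => (g j * s j).totalDegree,
      s₀, s, h0, by omega, fun j => ⟨hs j, ?_⟩, rfl⟩
    have := Finset.le_sup (f := fun j => (g j * s j).totalDegree) (Finset.mem_univ j)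
    omega

/-- The set `I(h) + Q(g)`. -/
def idealAddQM (h : Fin m₁ → MvPolynomial (Fin n) ℝ) (g : Fin m₂ → MvPolynomial (Fin n) ℝ) :
    Set (MvPolynomial (Fin n) ℝ) :=
  {p | ∃ f ∈ Ideal.span (Set.range h), ∃ q ∈ quadModule g, p = f + q}

theorem isQuadModule_idealAddQM (h : Fin m₁ → MvPolynomial (Fin n) ℝ)
    (g : Fin m₂ → MvPolynomial (Fin n) ℝ) : IsQuadModule (idealAddQM h g) where
  one_mem := ⟨0, zero_mem _, 1, mem_quadModule_iff.2
    ⟨1, 0, by simp,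
      fun _ => IsSumSq.zero, by simp⟩, by simp⟩
  add_mem := by
    rintro _ _ ⟨f, hf, q, hq, rfl⟩ ⟨f', hf', q', hq', rfl⟩
    obtain ⟨s₀, s, h0, hs, rfl⟩ := mem_quadModule_iff.1 hq
    obtain ⟨s₀', s', h0', hs', rfl⟩ := mem_quadModule_iff.1 hq'
    refine ⟨f + f', add_mem hf hf', _, mem_quadModule_iff.2
      ⟨s₀ + s₀', s + s', h0.add h0', fun j => (hs j).add (hs' j), rfl⟩, ?_⟩
    simp only [Pi.add_apply, mul_add, Finset.sum_add_distrib]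
    ring
  sq_mul_mem := by
    rintro a _ ⟨f, hf, q, hq, rfl⟩
    obtain ⟨s₀, s, h0, hs, rfl⟩ := mem_quadModule_iff.1 hq
    have ha : IsSumSq (a ^ 2) := by rw [sq]; exact IsSumSq.mul_self a
    refine ⟨a ^ 2 * f, Ideal.mul_mem_left _ _ hf, _, mem_quadModule_iff.2
      ⟨a ^ 2 * s₀, fun j => a ^ 2 * s j, ha.mul h0, fun j => ha.mul (hs j), rfl⟩, ?_⟩
    simp only [mul_add, Finset.mul_sum, mul_left_comm]

theorem eval_nonneg_of_mem_idealAddQM {h : Fin m₁ → MvPolynomial (Fin n) ℝ}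
    {g : Fin m₂ → MvPolynomial (Fin n) ℝ} {p : MvPolynomial (Fin n) ℝ} (hp : p ∈ idealAddQM h g)
    {u : Fin n → ℝ} (hu : u ∈ semialgSet h g) : 0 ≤ eval u p := by
  obtain ⟨f, hf, q, hq, rfl⟩ := hp
  obtain ⟨s₀, s, h0, hs, rfl⟩ := mem_quadModule_iff.1 hq
  have hfu : eval u f = 0 := by
    have : Ideal.span (Set.range h) ≤ RingHom.ker (eval u) :=
      Ideal.span_le.2 (by rintro _ ⟨i, rfl⟩; exact hu.1 i)
    exact this hf
  rw [map_add, hfu, zero_add, map_add, map_sum]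
  refine add_nonneg (IsSumSq.eval_nonneg h0 u) (Finset.sum_nonneg fun j _ => ?_)
  rw [map_mul]
  exact mul_nonneg (hu.2 j) (IsSumSq.eval_nonneg (hs j) u)

theorem generator_mem_idealAddQM (h : Fin m₁ → MvPolynomial (Fin n) ℝ)
    (g : Fin m₂ → MvPolynomial (Fin n) ℝ) (j : Fin m₂) : g j ∈ idealAddQM h g := by
  classical
  refine ⟨0, zero_mem _, g j, mem_quadModule_iff.2 ⟨0, Pi.single j 1, .zero, fun i => ?_, ?_⟩,
    by simp⟩
  · by_cases hij : i = j
    · subst hij; simp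
    · simp [hij]
  · simp [Pi.single_apply]

theorem ideal_subset_idealAddQM {h : Fin m₁ → MvPolynomial (Fin n) ℝ}
    (g : Fin m₂ → MvPolynomial (Fin n) ℝ) {f : MvPolynomial (Fin n) ℝ}
    (hf : f ∈ Ideal.span (Set.range h)) : f ∈ idealAddQM h g :=
  ⟨f, hf, 0, mem_quadModule_iff.2 ⟨0, 0, .zero, fun _ => .zero, by simp⟩, by simp⟩

/-- **Putinar's Positivstellensatz**. -/
theorem mem_idealAddQM_of_pos {h : Fin m₁ → MvPolynomial (Fin n) ℝ}
    {g : Fin m₂ → MvPolynomial (Fin n) ℝ} (harch : IsArchimedean h g)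
    {p : MvPolynomial (Fin n) ℝ} (hp : ∀ u ∈ semialgSet h g, 0 < eval u p) :
    p ∈ idealAddQM h g := by
  have hM := isQuadModule_idealAddQM h g
  obtain ⟨R, hR, f, hf, q, hq, hRe⟩ := harch
  refine mem_of_forall_algHom_pos hM (archimedeanModule_of_ball hM hR ⟨f, hf, q, hq, hRe⟩)
    fun φ hφ => ?_
  -- Homomorphisms to `ℝ` are point evaluations; nonnegativity on `±h i` and `g j` places the point
  -- in `K`.
  have hev : ∀ r, φ r = eval (fun i => φ (X i)) r := fun r => by
    conv_lhs => rw [aeval_unique φ]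
    rfl
  rw [hev]
  refine hp _ ⟨fun i => ?_, fun j => ?_⟩
  · have hi : h i ∈ Ideal.span (Set.range h) := Ideal.subset_span ⟨i, rfl⟩
    rw [← hev]
    have e1 := hφ _ (ideal_subset_idealAddQM g hi)
    have e2 := hφ _ (ideal_subset_idealAddQM g (neg_mem hi))
    rw [map_neg] at e2
    linarith
  · rw [← hev]
    exact hφ _ (generator_mem_idealAddQM h g j)

/-- Every element of `I(h) + Q(g)` lies in all truncations of large order. -/
theorem exists_trunc_of_mem_idealAddQM {h : Fin m₁ → MvPolynomial (Fin n) ℝ}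
    {g : Fin m₂ → MvPolynomial (Fin n) ℝ} {p : MvPolynomial (Fin n) ℝ} (hp : p ∈ idealAddQM h g) :
    ∃ k₀, ∀ k, k₀ ≤ k → ∃ q ∈ truncQM g k, ∃ f ∈ truncIdeal h (2 * k), p = q + f := by
  obtain ⟨f, hf, q, hq, rfl⟩ := hp
  obtain ⟨s₀, s, h0, hs, rfl⟩ := mem_quadModule_iff.1 hq
  obtain ⟨c, rfl⟩ := Ideal.mem_span_range_iff_exists_fun.1 hf
  refine ⟨s₀.totalDegree + (Finset.univ.sup fun j => (g j * s j).totalDegree) +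
    Finset.univ.sup fun i => (h i * c i).totalDegree, fun k hk =>
    ⟨_, ⟨s₀, s, h0, by omega, fun j => ⟨hs j, ?_⟩, rfl⟩, _, ⟨c, fun i => ?_, rfl⟩, ?_⟩⟩
  · have := Finset.le_sup (f := fun j => (g j * s j).totalDegree) (Finset.mem_univ j)
    omega
  · have := Finset.le_sup (f := fun i => (h i * c i).totalDegree) (Finset.mem_univ i)
    omega
  · rw [add_comm]
    simp only [mul_comm]

theorem isCompact_semialgSet {h : Fin m₁ → MvPolynomial (Fin n) ℝ}
    {g : Fin m₂ → MvPolynomial (Fin n) ℝ} (harch : IsArchimedean h g) :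
    IsCompact (semialgSet h g) := by
  obtain ⟨R, hR, hRM⟩ := harch
  refine (isCompact_univ_pi fun _ : Fin n => isCompact_Icc (a := -Real.sqrt R)
    (b := Real.sqrt R)).of_isClosed_subset ?_ ?_
  · have : semialgSet h g = (⋂ i, {u | eval u (h i) = 0}) ∩ ⋂ j, {u | 0 ≤ eval u (g j)} := by
      ext u; simp [semialgSet]
    rw [this]
    exact (isClosed_iInter fun i => isClosed_eq (MvPolynomial.continuous_eval _) continuous_const).inter
      (isClosed_iInter fun j => isClosed_le continuous_const (MvPolynomial.continuous_eval _))
  · intro u hu i _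
    have h0 : 0 ≤ eval u (C R - ∑ i, X i ^ 2) := eval_nonneg_of_mem_idealAddQM hRM hu
    simp only [map_sub, eval_C, map_sum, map_pow, eval_X] at h0
    have hi := Finset.single_le_sum (f := fun i => u i ^ 2) (fun i _ => sq_nonneg _)
      (Finset.mem_univ i)
    exact abs_le.1 (Real.abs_le_sqrt (by linarith))

end Putinar

/-! ### Moment cones, relaxations and certificates -/

section Moments

variable {n m m₁ m₂ : ℕ}

/-- The restrictions to `A` of the truncated sequences in `Φ_k(g) ∩ E_k(h)`. -/
def restrictedCone (A : Finset (Fin n →₀ ℕ)) (h : Fin m₁ → MvPolynomial (Fin n) ℝ)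
    (g : Fin m₂ → MvPolynomial (Fin n) ℝ) (k : ℕ) : PointedCone ℝ (A → ℝ) where
  carrier := {y | ∃ w ∈ Phi g k ∩ Ek h k,
    ∀ (α : A) (hα : (α : Fin n →₀ ℕ) ∈ expLE n (2 * k)), y α = w ⟨α, hα⟩}
  add_mem' := by
    rintro y y' ⟨w, ⟨⟨h0, hg⟩, hh⟩, hy⟩ ⟨w', ⟨⟨h0', hg'⟩, hh'⟩, hy'⟩
    refine ⟨w + w', ⟨⟨?_, fun j => ?_⟩, fun i => ?_⟩, fun α hα => ?_⟩
    · rw [locMatrix_add]; exact h0.add h0'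
    · rw [locMatrix_add]; exact (hg j).add (hg' j)
    · rw [locMatrix_add, hh i, hh' i, add_zero]
    · rw [Pi.add_apply, Pi.add_apply, hy α hα, hy' α hα]
  zero_mem' := by
    have h0 : ∀ q : MvPolynomial (Fin n) ℝ, locMatrix q k 0 = 0 := fun q => by
      simpa using locMatrix_smul q k 0 0
    refine ⟨0, ⟨⟨?_, fun j => ?_⟩, fun i => h0 _⟩, fun _ _ => rfl⟩ <;>
    · rw [h0]; exact Matrix.PosSemidef.zero
  smul_mem' := by
    rintro ⟨c, hc⟩ y ⟨w, ⟨⟨h0, hg⟩, hh⟩, hy⟩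
    refine ⟨c • w, ⟨⟨?_, fun j => ?_⟩, fun i => ?_⟩, fun α hα => ?_⟩
    · rw [locMatrix_smul]; exact h0.smul hc
    · rw [locMatrix_smul]; exact (hg j).smul hc
    · rw [locMatrix_smul, hh i, smul_zero]
    · change c • y α = c • w ⟨α, hα⟩
      rw [hy α hα]

theorem pointVec_mem_restrictedCone (A : Finset (Fin n →₀ ℕ))
    {h : Fin m₁ → MvPolynomial (Fin n) ℝ} {g : Fin m₂ → MvPolynomial (Fin n) ℝ} (k : ℕ)
    {u : Fin n → ℝ} (hu : u ∈ semialgSet h g) : pointVec A u ∈ restrictedCone A h g k := by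
  refine ⟨pointVec _ u, ⟨⟨posSemidef_locMatrix_pointVec k (by simp), fun j =>
    posSemidef_locMatrix_pointVec k (hu.2 j)⟩, fun i => ?_⟩, fun _ _ => rfl⟩
  rw [locMatrix_pointVec, hu.1 i, zero_smul]

theorem momentCone_subset_restrictedCone (A : Finset (Fin n →₀ ℕ))
    (h : Fin m₁ → MvPolynomial (Fin n) ℝ) (g : Fin m₂ → MvPolynomial (Fin n) ℝ) (k : ℕ)
    {y : A → ℝ} (hy : y ∈ momentCone A (semialgSet h g)) : y ∈ restrictedCone A h g k := by
  obtain ⟨μ, hμ, hint⟩ := hy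
  have hyv : y = ∫ u, pointVec A u ∂μ := by
    ext α
    rw [(hint α).2]
    exact (eval_integral (f := pointVec A) (fun α => (hint α).1) α).symm
  have hmem := integral_mem_cone (v := pointVec A) (Integrable.of_eval fun α => (hint α).1) hμ
  rw [← hyv] at hmem
  refine (Submodule.span_le.2 ?_ : PointedCone.hull ℝ _ ≤ restrictedCone A h g k) hmem
  rintro _ ⟨u, hu, rfl⟩
  exact pointVec_mem_restrictedCone A k hu

/-- The right-hand sides `b` for which the moment problem is feasible. -/
def feasibleCone (A : Finset (Fin n →₀ ℕ)) (K : Set (Fin n → ℝ))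
    (a : Fin m → MvPolynomial (Fin n) ℝ) : PointedCone ℝ (Fin m → ℝ) where
  carrier := {b | ∃ y ∈ momentCone A K, ∀ i, riesz (a i) y = b i}
  add_mem' := by
    rintro b b' ⟨y, ⟨μ, hμ, hy⟩, hb⟩ ⟨y', ⟨μ', hμ', hy'⟩, hb'⟩
    refine ⟨y + y', ⟨μ + μ', by simp [hμ, hμ'], fun α =>
      ⟨(hy α).1.add_measure (hy' α).1, ?_⟩⟩, fun i => ?_⟩
    · rw [integral_add_measure (hy α).1 (hy' α).1, Pi.add_apply, (hy α).2, (hy' α).2]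
    · rw [riesz_add_right, hb, hb', Pi.add_apply]
  zero_mem' := ⟨0, ⟨0, by simp, fun α => ⟨integrable_zero_measure, by simp⟩⟩, by simp [riesz]⟩
  smul_mem' := by
    rintro ⟨c, hc⟩ b ⟨y, ⟨μ, hμ, hy⟩, hb⟩
    refine ⟨c • y, ⟨ENNReal.ofReal c • μ, by simp [hμ], fun α =>
      ⟨(hy α).1.smul_measure ENNReal.ofReal_ne_top, ?_⟩⟩, fun i => ?_⟩
    · rw [integral_smul_measure, ENNReal.toReal_ofReal hc, Pi.smul_apply, (hy α).2]
    · rw [riesz_smul_right, hb]; rfl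

theorem eval_mem_feasibleCone {A : Finset (Fin n →₀ ℕ)} {K : Set (Fin n → ℝ)}
    {a : Fin m → MvPolynomial (Fin n) ℝ} (ha : ∀ i, a i ∈ polysOn A) {u : Fin n → ℝ}
    (hu : u ∈ K) : (fun i => eval u (a i)) ∈ feasibleCone A K a := by
  refine ⟨pointVec A u, ⟨Measure.dirac u, by simp [Measure.dirac_apply, hu], fun α =>
    ⟨integrable_dirac (by simp), by rw [integral_dirac]; rfl⟩⟩, fun i => ?_⟩
  rw [riesz_pointVec (support_subset_of_mem_polysOn (ha i))]

theorem subset_expLE_of_degSet_le {A : Finset (Fin n →₀ ℕ)} {d : ℕ} (h : degSet A ≤ d) :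
    A ⊆ expLE n d := fun _ hα => mem_expLE.2 ((Finset.le_sup (f := Finsupp.degree) hα).trans h)

theorem relaxFeasible_eq_empty_of_isCertificate {h : Fin m₁ → MvPolynomial (Fin n) ℝ}
    {g : Fin m₂ → MvPolynomial (Fin n) ℝ} {A : Finset (Fin n →₀ ℕ)}
    {a : Fin m → MvPolynomial (Fin n) ℝ} (ha : ∀ i, a i ∈ polysOn A) {b lam : Fin m → ℝ}
    {k k' : ℕ} (hcert : IsCertificate h g a b lam k) (hk : k ≤ k') (hA : degSet A ≤ 2 * k')
    (hk' : k < k' ∨ ∀ i, Even (h i).totalDegree) : relaxFeasible A h g a b k' = ∅ := by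
  rw [Set.eq_empty_iff_forall_notMem]
  rintro y ⟨hb, hy⟩
  obtain ⟨w, ⟨⟨hw0, hwg⟩, hwh⟩, hyw⟩ := hy hA
  obtain ⟨hneg, _, ⟨s₀, s, h0, h0d, hs, rfl⟩, _, ⟨c, hc, rfl⟩, hsum⟩ := hcert
  have hval : rieszLin w (∑ i, lam i • a i) = ∑ i, b i * lam i := by
    rw [map_sum]
    refine Finset.sum_congr rfl fun i _ => ?_
    rw [map_smul, rieszLin_apply, smul_eq_mul, ← hb i, mul_comm, riesz_eq_of_restrict
      (subset_expLE_of_degSet_le hA) (support_subset_of_mem_polysOn (ha i)) hyw]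
  rw [hsum] at hval
  simp only [map_add, map_sum, rieszLin_apply] at hval
  have e0 : 0 ≤ riesz s₀ w := by
    have := riesz_mul_sumSq_nonneg (q := 1) hw0 h0 (by rw [one_mul]; omega)
    rwa [one_mul] at this
  have e1 : 0 ≤ ∑ j, riesz (g j * s j) w := Finset.sum_nonneg fun j _ =>
    riesz_mul_sumSq_nonneg (hwg j) (hs j).1 (by have := (hs j).2; omega)
  have e2 : ∑ i, riesz (h i * c i) w = 0 := Finset.sum_eq_zero fun i _ =>
    riesz_mul_eq_zero (hwh i) (hc i) hk (hk'.imp_right fun H => H i)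
  linarith

/-- Infeasibility over an archimedean description is certified at all large orders. -/
theorem exists_isCertificate {h : Fin m₁ → MvPolynomial (Fin n) ℝ}
    {g : Fin m₂ → MvPolynomial (Fin n) ℝ} {A : Finset (Fin n →₀ ℕ)}
    {a : Fin m → MvPolynomial (Fin n) ℝ} (ha : ∀ i, a i ∈ polysOn A) {b : Fin m → ℝ}
    (harch : IsArchimedean h g) {p : MvPolynomial (Fin n) ℝ}
    (hp : p ∈ Submodule.span ℝ (Set.range a)) (hpos : ∀ u ∈ semialgSet h g, 0 < eval u p)
    (hinf : momentFeasible A h g a b = ∅) :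
    ∃ (lam : Fin m → ℝ) (k₀ : ℕ), ∀ k, k₀ ≤ k → IsCertificate h g a b lam k := by
  set K := semialgSet h g
  set T : Set (Fin m → ℝ) := (fun u i => eval u (a i)) '' K
  have hT : IsCompact T := (isCompact_semialgSet harch).image
    (continuous_pi fun i => MvPolynomial.continuous_eval (a i))
  -- Dirac measures realize the points of `T`, and the feasible right-hand sides form a cone.
  have hb : b ∉ PointedCone.hull ℝ T := fun hb => by
    have hle : PointedCone.hull ℝ T ≤ feasibleCone A K a := Submodule.span_le.2 (by
      rintro _ ⟨u, hu, rfl⟩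
      exact eval_mem_feasibleCone ha hu)
    obtain ⟨y, hy, hyb⟩ := hle hb
    exact Set.eq_empty_iff_forall_notMem.1 hinf y ⟨hyb, hy⟩
  obtain ⟨c, rfl⟩ := (Submodule.mem_span_range_iff_exists_fun ℝ).1 hp
  have hev : ∀ (ℓ : (Fin m → ℝ) →ₗ[ℝ] ℝ) (x : Fin m → ℝ),
      ℓ x = ∑ i, x i * ℓ fun j => if i = j then 1 else 0 := fun ℓ x =>
    LinearMap.pi_apply_eq_sum_univ ℓ x
  have hsum : ∀ (l : Fin m → ℝ) (u : Fin n → ℝ),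
      eval u (∑ i, l i • a i) = ∑ i, eval u (a i) * l i := fun l u => by
    rw [map_sum]
    exact Finset.sum_congr rfl fun i _ => by rw [smul_eval, mul_comm]
  -- The coefficients `c` of the polynomial positive on `K` define the open half space containing
  -- `T`.
  obtain ⟨ℓ, hℓT, hℓb⟩ := exists_pos_of_notMem_cone hT (Fintype.linearCombination ℝ c) (by
    rintro _ ⟨u, hu, rfl⟩
    have := hpos u hu
    rw [hsum] at this
    simpa [Fintype.linearCombination_apply] using this) hb
  set lam : Fin m → ℝ := fun i => ℓ fun j => if i = j then 1 else 0
  have hlamb : ∑ i, b i * lam i < 0 := by rw [← hev]; exact hℓb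
  have hlampos : ∀ u ∈ K, 0 < eval u (∑ i, lam i • a i) := fun u hu => by
    rw [hsum, ← hev ℓ fun i => eval u (a i)]
    exact hℓT _ ⟨u, hu, rfl⟩
  obtain ⟨k₀, hk₀⟩ := exists_trunc_of_mem_idealAddQM (mem_idealAddQM_of_pos harch hlampos)
  exact ⟨lam, k₀, fun k hk => ⟨hlamb, hk₀ k hk⟩⟩

end Moments

end MomCone

end

theorem mainTheorem8 {n m m₁ m₂ : ℕ}
    (h : Fin m₁ → MvPolynomial (Fin n) ℝ) (g : Fin m₂ → MvPolynomial (Fin n) ℝ)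
    (A : Finset (Fin n →₀ ℕ))
    (a : Fin m → MvPolynomial (Fin n) ℝ) (ha : ∀ i, a i ∈ MomCone.polysOn A)
    (b : Fin m → ℝ) :
    -- (i), first claim
    ((∃ k, MomCone.relaxFeasible A h g a b k = ∅) → MomCone.momentFeasible A h g a b = ∅) ∧
    -- (i), second claim
    (∀ (lam : Fin m → ℝ) (k : ℕ), MomCone.IsCertificate h g a b lam k →
      ∀ k', k ≤ k' → MomCone.degSet A ≤ 2 * k' →
        (k < k' ∨ ∀ i, Even (h i).totalDegree) →
        MomCone.relaxFeasible A h g a b k' = ∅) ∧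
    -- (ii)
    (MomCone.IsArchimedean h g →
      (∃ p ∈ Submodule.span ℝ (Set.range a),
        ∀ u ∈ MomCone.semialgSet h g, 0 < MvPolynomial.eval u p) →
      MomCone.momentFeasible A h g a b = ∅ →
      ∃ (lam : Fin m → ℝ) (k : ℕ), MomCone.degSet A ≤ 2 * k ∧
        MomCone.IsCertificate h g a b lam k ∧
        ∀ k', k ≤ k' → MomCone.relaxFeasible A h g a b k' = ∅) := by
  refine ⟨?_, fun lam k hcert k' hk hA hk' =>
    MomCone.relaxFeasible_eq_empty_of_isCertificate ha hcert hk hA hk', ?_⟩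
  · rintro ⟨k, hk⟩
    rw [Set.eq_empty_iff_forall_notMem] at hk ⊢
    rintro y ⟨hb, hy⟩
    exact hk y ⟨hb, fun _ => MomCone.momentCone_subset_restrictedCone A h g k hy⟩
  · rintro harch ⟨p, hp, hpos⟩ hinf
    obtain ⟨lam, k₀, hcert⟩ := MomCone.exists_isCertificate ha harch hp hpos hinf
    -- The `+ 1` leaves a certificate of order one lower, so infeasibility at the chosen order
    -- itself needs no parity assumption on the `h i`.
    refine ⟨lam, k₀ + MomCone.degSet A + 1, by omega, hcert _ (by omega), fun k' hk' => ?_⟩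
    exact MomCone.relaxFeasible_eq_empty_of_isCertificate ha
      (hcert (k₀ + MomCone.degSet A) (by omega)) (by omega) (by omega) (Or.inl (by omega))
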